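/- Let $H$ be a separable (real or complex) Hilbert space and let $A$ be an unbounded positive self-adjoint operator in $H$ with a complete orthonormal system of eigenvectors $(v_k)_{k\ge 1}$, $Av_k=\lambda_k v_k$, where $0<\lambda_1\le\lambda_2\le\dots\to+\infty$. Let $0<\rho<1$ and $T>0$. For a function $h$ with values in $H$ put $$\partial_t^{\rho-1}h(t)=\frac1{\Gamma(1-\rho)}\int_0^t\frac{h(\xi)}{(t-\xi)^{\rho}}\,d\xi,\qquad \partial_t^{\rho}h(t)=\frac{d}{dt}\,\partial_t^{\rho-1}h(t)$$ (strong integral and strong derivative), and let $$D(A^2)=\Big\{g\in H:\ \|g\|_2^2:=\sum_{k\ge1}\lambda_k^{4}\,|(g,v_k)|^2<\infty\Big\}.$$ For $\Phi\in H$, a solution of the backward problem $$\partial_t^\rho u(t)+Au(t)=0\quad(0<t<T),\qquad u(T)=\Phi,$$ is a function $u\in C((0,T];H)$ such that $\partial_t^\rho u$ and $Au$ exist and belong to $C((0,T);H)$ and both conditions hold. Then for every $\Phi\in D(A^2)$ the backward problem has a unique solution $u$ (on $(0,T]$). Moreover, there exist constants $C_1,C_2>0$, independent of $\Phi$, such that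 for every $\Phi\in D(A^2)$ the solution $u$ satisfies: the limit $\lim_{t\to0+}\|\partial_t^{\rho-1}u(t)\|$ exists and is finite, and $$C_1\lim_{t\to0+}\|\partial_t^{\rho-1}u(t)\|\ \le\ \|u(T)\|_2\ \le\ C_2\lim_{t\to0+}\|\partial_t^{\rho-1}u(t)\|.$$ -/

import Mathlib

open Set Filter Topology MeasureTheory

noncomputable section

namespace BackwardSubdiffusion

section Fractional

variable {H : Type*} [NormedAddCommGroup H] [NormedSpace ℝ H]

/-- The integrand `h(ξ) / (t - ξ)^(σ + 1)` of the fractional integral of order `σ < 0`. -/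
def fracIntegrand (σ : ℝ) (h : ℝ → H) (t ξ : ℝ) : H :=
  ((t - ξ) ^ (σ + 1))⁻¹ • h ξ

/-- The fractional integral of order `σ < 0` of `h` exists at `t`
(as a strong, i.e. Bochner, integral). -/
def HasFracIntegral (σ : ℝ) (h : ℝ → H) (t : ℝ) : Prop :=
  IntervalIntegrable (fracIntegrand σ h t) volume 0 t

/-- The Riemann-Liouville fractional integral of order `σ < 0`:
`∂_t^σ h(t) = 1 / Γ(-σ) * ∫_0^t h(ξ) / (t - ξ)^(σ + 1) dξ`. -/
def fracIntegral (σ : ℝ) (h : ℝ → H) (t : ℝ) : H :=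
  (Real.Gamma (-σ))⁻¹ • ∫ ξ in (0 : ℝ)..t, fracIntegrand σ h t ξ

/-- The Riemann-Liouville derivative of order `0 < ρ < 1`:
`∂_t^ρ h = (d/dt) ∂_t^(ρ - 1) h`. -/
def rlDeriv (ρ : ℝ) (h : ℝ → H) (t : ℝ) : H :=
  deriv (fracIntegral (ρ - 1) h) t

end Fractional

section Operator

variable {𝕜 : Type*} [RCLike 𝕜] {H : Type*} [NormedAddCommGroup H] [InnerProductSpace 𝕜 H]

/-- The domain `D(A^τ)` of the power `A^τ` of the operator with eigenvectors `v k` and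
eigenvalues `lam k`: all `g` with `∑ lam k ^ (2 τ) |(g, v k)|² < ∞`. -/
def powDomain (v : HilbertBasis ℕ 𝕜 H) (lam : ℕ → ℝ) (τ : ℝ) : Set H :=
  {g | Summable fun k => lam k ^ (2 * τ) * ‖inner 𝕜 (v k) g‖ ^ 2}

/-- The norm `‖g‖_τ = ‖A^τ g‖ = (∑ lam k ^ (2 τ) |(g, v k)|²)^(1/2)` of `g ∈ D(A^τ)`. -/
def powNorm (v : HilbertBasis ℕ 𝕜 H) (lam : ℕ → ℝ) (τ : ℝ) (g : H) : ℝ :=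
  Real.sqrt (∑' k, lam k ^ (2 * τ) * ‖inner 𝕜 (v k) g‖ ^ 2)

/-- `u` is a solution of the backward problem
`∂_t^ρ u(t) + A u(t) = f(t)` for `0 < t < T`, `u(T) = Φ`:
`u ∈ C((0,T]; H)`, both `∂_t^ρ u` and `A u` exist and are continuous on `(0,T)`, and the
equation and the final condition hold. Only the values of `u` on `(0,T]` matter. -/
structure IsBackwardSolution [NormedSpace ℝ H] (A : H →ₗ.[𝕜] H) (ρ T : ℝ) (f : ℝ → H) (Φ : H)
    (u : ℝ → H) : Prop where
  continuousOn : ContinuousOn u (Ioc 0 T)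
  hasFracIntegral : ∀ t ∈ Ioo 0 T, HasFracIntegral (ρ - 1) u t
  differentiableAt : ∀ t ∈ Ioo 0 T, DifferentiableAt ℝ (fracIntegral (ρ - 1) u) t
  continuousOn_rlDeriv : ContinuousOn (rlDeriv ρ u) (Ioo 0 T)
  mem_domain : ∀ t ∈ Ioo 0 T, u t ∈ A.domain
  continuous_apply : Continuous fun t : Ioo 0 T => A ⟨u t, mem_domain t t.2⟩
  equation : ∀ t (ht : t ∈ Ioo 0 T), rlDeriv ρ u t + A ⟨u t, mem_domain t ht⟩ = f t
  final : u T = Φ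

end Operator

end BackwardSubdiffusion

end

/-!
The fractional relaxation equation `∂_t^ρ y + λ y = 0` has, up to a scalar, one solution,
`e_λ(t) = t ^ (ρ - 1) E_{ρ,ρ}(-λ t ^ ρ)` (`mlKernel ρ ρ λ`), whose fractional integral
`∂_t^(ρ-1) e_λ` is `F_λ(t) = E_{ρ,1}(-λ t ^ ρ)` (`mlKernel ρ 1 λ`), with `F_λ(0) = 1` and
`F_λ' = -λ e_λ`. Taking Fourier coefficients, a solution of the backward problem has the
coefficients `e_{λ_k}(t) c_k`, and `∂_t^(ρ-1) u` has the coefficients `F_{λ_k}(t) c_k`, which tend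
to `c_k` as `t → 0+`. The limit of `‖∂_t^(ρ-1) u(t)‖` is therefore the `ℓ²` norm of `c`, and since
`c_k = (Φ, v_k) / e_{λ_k}(T)`, the theorem says that `λ ^ 2 e_λ(T)` lies between positive constants
for `λ ≥ λ_0 > 0` (`exists_sq_mul_mlKernel_self_bounds`).

Uniqueness and the bounds come from one identity, `fracIntegral_sub_mlKernel_one_smul`: if
`g = ∂_t^(ρ-1) y` has `g' = -μ y`, then differentiating `F_λ(t - s) g(s)` in `s` and using Fubini's
theorem gives `g(t) - F_λ(t) g(0+) = (λ - μ) ∫₀ᵗ F_λ(t - s) y(s) ds`. For `μ = λ` it identifies all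
solutions. For `y = e_μ` and `t = 1` it expresses the difference quotients of `G(x) = E_{ρ,1}(-x)`
by integrals of `F_λ(1 - s) e_μ(s)`. As `e_μ ≥ 0` (`mittagLeffler_pos`, a first-zero argument), `G`
is decreasing, hence so is `λ ↦ F_λ`, hence `G` is convex. The monotonicity of `F_λ` in the Volterra
equations gives `1 / (1 + Γ(1 - ρ) x) ≤ G(x) ≤ Γ(1 + ρ) / x`, and since `-ρ G'(x) = E_{ρ,ρ}(-x)`,
convexity turns these bounds into bounds of `E_{ρ,ρ}(-x)` by multiples of `x⁻²`.
-/

noncomputable section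

namespace BackwardSubdiffusion

/-! ### The Beta integral -/

theorem intervalIntegrable_beta {a b t : ℝ} (ha : 0 < a) (hb : 0 < b) (ht : 0 < t) :
    IntervalIntegrable (fun s : ℝ => (t - s) ^ (a - 1) * s ^ (b - 1)) volume 0 t := by
  have hleft : ∀ {c d : ℝ}, 0 < c →
      IntervalIntegrable (fun s : ℝ => s ^ (c - 1) * (t - s) ^ (d - 1)) volume 0 (t / 2) := by
    intro c d hc
    refine (intervalIntegral.intervalIntegrable_rpow' (by linarith)).mul_continuousOn ?_
    intro s hs
    rw [uIcc_of_le (by positivity)] at hs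
    refine ContinuousAt.continuousWithinAt (ContinuousAt.rpow_const (by fun_prop) (Or.inl ?_))
    have := hs.2
    intro h
    linarith
  have h1 := hleft (d := a) hb
  have h2 := (hleft (d := b) ha).comp_sub_left t
  simp only [sub_zero, sub_sub_cancel, sub_half] at h2
  refine (h1.congr ?_).trans h2.symm
  exact fun s _ => mul_comm _ _

theorem integral_beta {a b t : ℝ} (ha : 0 < a) (hb : 0 < b) (ht : 0 < t) :
    ∫ s in (0 : ℝ)..t, (t - s) ^ (a - 1) * s ^ (b - 1) =
      Real.Gamma a * Real.Gamma b / Real.Gamma (a + b) * t ^ (a + b - 1) := by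
  have h := Complex.betaIntegral_scaled b a ht
  rw [Complex.betaIntegral_eq_Gamma_mul_div _ _ (by simpa) (by simpa)] at h
  apply Complex.ofReal_injective
  rw [← intervalIntegral.integral_ofReal]
  push_cast
  rw [Complex.ofReal_cpow ht.le, ← Complex.Gamma_ofReal, ← Complex.Gamma_ofReal,
    ← Complex.Gamma_ofReal]
  push_cast
  rw [add_comm (b : ℂ) a] at h
  rw [mul_comm (Complex.Gamma a), mul_comm (_ / _), ← h]
  refine intervalIntegral.integral_congr fun s hs => ?_
  rw [uIcc_of_le ht.le] at hs
  rw [Complex.ofReal_cpow (sub_nonneg.2 hs.2), Complex.ofReal_cpow hs.1, mul_comm]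
  push_cast
  rfl

/-! ### The Mittag-Leffler function -/

/-- The two-parameter Mittag-Leffler function `E_{ρ,β}(z) = ∑ zⁿ / Γ(ρ n + β)` on the real line. -/
def mittagLeffler (ρ β z : ℝ) : ℝ :=
  ∑' n : ℕ, z ^ n / Real.Gamma (ρ * n + β)

/-- Log-convexity between `x + ρ - 1` and `x + ρ` gives `Γ(x) ≤ Γ(x + ρ) (x + ρ - 1) ^ (-ρ)`. -/
theorem tendsto_Gamma_div_Gamma_add {ρ : ℝ} (hρ : ρ ∈ Ioo (0 : ℝ) 1) :
    Tendsto (fun x => Real.Gamma x / Real.Gamma (x + ρ)) atTop (𝓝 0) := by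
  have hlim : Tendsto (fun x : ℝ => (x + (ρ - 1)) ^ (-ρ)) atTop (𝓝 0) :=
    (tendsto_rpow_neg_atTop hρ.1).comp (tendsto_atTop_add_const_right _ _ tendsto_id)
  refine tendsto_of_tendsto_of_tendsto_of_le_of_le' tendsto_const_nhds hlim ?_ ?_
  · filter_upwards [eventually_gt_atTop 0] with x hx
    have := Real.Gamma_pos_of_pos hx
    have := Real.Gamma_pos_of_pos (add_pos hx hρ.1)
    positivity
  · filter_upwards [eventually_gt_atTop 1] with x hx
    have hy : 0 < x + (ρ - 1) := by linarith [hρ.1]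
    have hg := Real.Gamma_pos_of_pos hy
    have hG := Real.Gamma_pos_of_pos (show 0 < x + ρ by linarith [hρ.1])
    have h := Real.Gamma_mul_add_mul_le_rpow_Gamma_mul_rpow_Gamma hy
      (show 0 < x + ρ by linarith [hρ.1]) hρ.1 (sub_pos.2 hρ.2) (by ring)
    rw [show ρ * (x + (ρ - 1)) + (1 - ρ) * (x + ρ) = x by ring] at h
    have hrec : Real.Gamma (x + ρ) = (x + (ρ - 1)) * Real.Gamma (x + (ρ - 1)) := by
      rw [← Real.Gamma_add_one hy.ne']
      ring_nf
    rw [div_le_iff₀ hG]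
    refine h.trans_eq ?_
    have h1 : Real.Gamma (x + (ρ - 1)) = Real.Gamma (x + ρ) * (x + (ρ - 1))⁻¹ := by
      rw [hrec]; field_simp
    rw [h1, Real.mul_rpow hG.le (inv_nonneg.2 hy.le), Real.inv_rpow hy.le, Real.rpow_neg hy.le]
    have h2 : Real.Gamma (x + ρ) ^ ρ * Real.Gamma (x + ρ) ^ (1 - ρ) = Real.Gamma (x + ρ) := by
      rw [← Real.rpow_add hG]; simp
    linear_combination ((x + (ρ - 1)) ^ ρ)⁻¹ * h2

variable {ρ β : ℝ}

theorem Gamma_mul_add_pos (hρ : ρ ∈ Ioo (0 : ℝ) 1) (hβ : 0 < β) (n : ℕ) :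
    0 < Real.Gamma (ρ * n + β) := by
  have := hρ.1
  exact Real.Gamma_pos_of_pos (by positivity)

theorem summable_mittagLeffler (hρ : ρ ∈ Ioo (0 : ℝ) 1) (hβ : 0 < β) (z : ℝ) :
    Summable fun n : ℕ => z ^ n / Real.Gamma (ρ * n + β) := by
  rcases eq_or_ne z 0 with rfl | hz
  · refine summable_of_ne_finset_zero (s := {0}) fun n hn => ?_
    simp [zero_pow (by simpa using hn : n ≠ 0)]
  have hG := Gamma_mul_add_pos hρ hβ
  refine summable_of_ratio_test_tendsto_lt_one zero_lt_one
    (Eventually.of_forall fun n => div_ne_zero (pow_ne_zero _ hz) (hG n).ne') ?_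
  have hx : Tendsto (fun n : ℕ => ρ * n + β) atTop atTop :=
    tendsto_atTop_add_const_right _ _
      (tendsto_natCast_atTop_atTop.const_mul_atTop hρ.1)
  have h := ((tendsto_Gamma_div_Gamma_add hρ).comp hx).const_mul |z|
  rw [mul_zero] at h
  refine h.congr fun n => ?_
  have h1 : ρ * ((n + 1 : ℕ) : ℝ) + β = ρ * n + β + ρ := by push_cast; ring
  have h2 := hG (n + 1)
  rw [h1] at h2
  have h3 := abs_pos.2 hz
  simp only [Function.comp, norm_div, norm_pow, Real.norm_eq_abs, h1, abs_of_pos (hG n),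
    abs_of_pos h2]
  have := hG n
  field_simp
  ring

theorem hasSum_mittagLeffler (hρ : ρ ∈ Ioo (0 : ℝ) 1) (hβ : 0 < β) (z : ℝ) :
    HasSum (fun n : ℕ => z ^ n / Real.Gamma (ρ * n + β)) (mittagLeffler ρ β z) :=
  (summable_mittagLeffler hρ hβ z).hasSum

theorem continuous_mittagLeffler (hρ : ρ ∈ Ioo (0 : ℝ) 1) (hβ : 0 < β) :
    Continuous (mittagLeffler ρ β) := by
  rw [continuous_iff_continuousAt]
  intro z
  have h : ContinuousOn (mittagLeffler ρ β) (Metric.ball 0 (|z| + 1)) := by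
    refine continuousOn_tsum (fun n => by fun_prop) (summable_mittagLeffler hρ hβ (|z| + 1))
      fun n w hw => ?_
    rw [mem_ball_zero_iff, Real.norm_eq_abs] at hw
    rw [norm_div, norm_pow, Real.norm_eq_abs, Real.norm_eq_abs,
      abs_of_pos (Gamma_mul_add_pos hρ hβ n)]
    have := Gamma_mul_add_pos hρ hβ n
    gcongr
  exact h.continuousAt (Metric.isOpen_ball.mem_nhds (by simp))

theorem mittagLeffler_zero (hρ : ρ ∈ Ioo (0 : ℝ) 1) (hβ : 0 < β) :
    mittagLeffler ρ β 0 = (Real.Gamma β)⁻¹ := by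
  have h := hasSum_single (f := fun n : ℕ => (0 : ℝ) ^ n / Real.Gamma (ρ * n + β)) 0
    fun n hn => by simp [zero_pow hn]
  simpa using (hasSum_mittagLeffler hρ hβ 0).unique h

theorem mittagLeffler_eq_add (hρ : ρ ∈ Ioo (0 : ℝ) 1) (hβ : 0 < β) (z : ℝ) :
    mittagLeffler ρ β z = (Real.Gamma β)⁻¹ + z * mittagLeffler ρ (β + ρ) z := by
  rw [mittagLeffler, (summable_mittagLeffler hρ hβ z).tsum_eq_zero_add, mittagLeffler,
    ← tsum_mul_left]
  congr 1
  · simp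
  · refine tsum_congr fun n => ?_
    rw [pow_succ', mul_div_assoc]
    congr 3
    push_cast
    ring

/-- The function `t ^ (β - 1) * E_{ρ,β}(-μ t ^ ρ)`. For `β = 1` it is the relaxation function, whose
value at `0` is `1`; `-μ` times the function for `β = ρ` is the derivative of that one. -/
def mlKernel (ρ β μ t : ℝ) : ℝ :=
  t ^ (β - 1) * mittagLeffler ρ β (-(μ * t ^ ρ))

theorem continuous_mittagLeffler_rpow (hρ : ρ ∈ Ioo (0 : ℝ) 1) (hβ : 0 < β) (μ : ℝ) :
    Continuous fun t : ℝ => mittagLeffler ρ β (-(μ * t ^ ρ)) :=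
  (continuous_mittagLeffler hρ hβ).comp
    (continuous_const.mul (Real.continuous_rpow_const hρ.1.le)).neg

theorem continuousOn_mlKernel (hρ : ρ ∈ Ioo (0 : ℝ) 1) (hβ : 0 < β) (μ : ℝ) :
    ContinuousOn (mlKernel ρ β μ) (Ioi 0) :=
  (continuousOn_id.rpow_const fun _ ht => Or.inl (ne_of_gt ht)).mul
    (continuous_mittagLeffler_rpow hρ hβ μ).continuousOn

theorem intervalIntegrable_rpow_mul_mlKernel (hρ : ρ ∈ Ioo (0 : ℝ) 1) {α : ℝ} (hα : 0 < α)
    (hβ : 0 < β) (μ : ℝ) {t : ℝ} (ht : 0 < t) :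
    IntervalIntegrable (fun s => (t - s) ^ (α - 1) * mlKernel ρ β μ s) volume 0 t := by
  refine ((intervalIntegrable_beta hα hβ ht).mul_continuousOn
    (continuous_mittagLeffler_rpow hρ hβ μ).continuousOn).congr fun s _ => ?_
  simp only [mlKernel, mul_assoc]

/-- The Riemann-Liouville integral of order `α` raises the second parameter by `α`. -/
theorem integral_rpow_mul_mlKernel (hρ : ρ ∈ Ioo (0 : ℝ) 1) {α : ℝ} (hα : 0 < α)
    (hβ : 0 < β) (μ : ℝ) {t : ℝ} (ht : 0 < t) :
    ∫ s in (0 : ℝ)..t, (t - s) ^ (α - 1) * mlKernel ρ β μ s =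
      Real.Gamma α * mlKernel ρ (β + α) μ t := by
  have hρ0 := hρ.1
  set f : ℕ → ℝ → ℝ := fun n s =>
    (-μ) ^ n / Real.Gamma (ρ * n + β) * ((t - s) ^ (α - 1) * s ^ (ρ * n + β - 1)) with hf
  have hpos : ∀ n : ℕ, 0 < ρ * n + β := fun n => by positivity
  have hG := Gamma_mul_add_pos hρ hβ
  have hGα := Real.Gamma_pos_of_pos hα
  have hii : ∀ n, IntervalIntegrable (f n) volume 0 t := fun n =>
    (intervalIntegrable_beta hα (hpos n) ht).const_mul _
  have hbeta : ∀ n : ℕ, ∫ s in (0 : ℝ)..t, (t - s) ^ (α - 1) * s ^ (ρ * n + β - 1) =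
      Real.Gamma α * Real.Gamma (ρ * n + β) / Real.Gamma (ρ * n + (β + α)) *
        (t ^ (β + α - 1) * (t ^ ρ) ^ n) := by
    intro n
    rw [integral_beta hα (hpos n) ht, ← Real.rpow_mul_natCast ht.le, ← Real.rpow_add ht]
    congr 2 <;> ring_nf
  have hval : ∀ n, ∫ s in (0 : ℝ)..t, f n s =
      Real.Gamma α * t ^ (β + α - 1) * ((-(μ * t ^ ρ)) ^ n / Real.Gamma (ρ * n + (β + α))) := by
    intro n
    rw [hf, intervalIntegral.integral_const_mul, hbeta, ← neg_mul, mul_pow]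
    have := hG n
    field_simp
  have hnorm : ∀ n, ∫ s in Ioc 0 t, ‖f n s‖ =
      Real.Gamma α * t ^ (β + α - 1) * ((|μ| * t ^ ρ) ^ n / Real.Gamma (ρ * n + (β + α))) := by
    intro n
    have h1 : ∫ s in Ioc 0 t, ‖f n s‖ = ∫ s in (0 : ℝ)..t,
        |μ| ^ n / Real.Gamma (ρ * n + β) * ((t - s) ^ (α - 1) * s ^ (ρ * n + β - 1)) := by
      rw [intervalIntegral.integral_of_le ht.le]
      refine setIntegral_congr_fun measurableSet_Ioc fun s hs => ?_
      simp only [hf, norm_mul, norm_div, norm_pow, norm_neg, Real.norm_eq_abs, abs_of_pos (hG n)]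
      rw [abs_of_nonneg (Real.rpow_nonneg (sub_nonneg.2 hs.2) _),
        abs_of_nonneg (Real.rpow_nonneg hs.1.le _)]
    rw [h1, intervalIntegral.integral_const_mul, hbeta, mul_pow]
    have := hG n
    field_simp
  have hs := hasSum_integral_of_summable_integral_norm (μ := volume.restrict (Ioc 0 t)) (F := f)
    (fun n => (intervalIntegrable_iff_integrableOn_Ioc_of_le ht.le).1 (hii n)) (by
      simp only [hnorm]
      exact (summable_mittagLeffler hρ (add_pos hβ hα) _).mul_left _)
  simp only [← intervalIntegral.integral_of_le ht.le, hval] at hs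
  have hs2 := (hasSum_mittagLeffler hρ (add_pos hβ hα) (-(μ * t ^ ρ))).mul_left
    (Real.Gamma α * t ^ (β + α - 1))
  rw [mlKernel, ← mul_assoc, hs2.unique hs]
  refine intervalIntegral.integral_congr_ae (Eventually.of_forall fun s hs => ?_)
  rw [uIoc_of_le ht.le] at hs
  rw [mlKernel, mittagLeffler, ← tsum_mul_left, ← tsum_mul_left]
  refine tsum_congr fun n => ?_
  have : s ^ (ρ * n + β - 1) = s ^ (β - 1) * (s ^ ρ) ^ n := by
    rw [← Real.rpow_mul_natCast hs.1.le, ← Real.rpow_add hs.1]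
    congr 1; ring
  simp only [hf, this, ← neg_mul, mul_pow]
  ring

theorem mlKernel_eq_sub (hρ : ρ ∈ Ioo (0 : ℝ) 1) (hβ : 0 < β) (μ : ℝ) {t : ℝ} (ht : 0 < t) :
    mlKernel ρ β μ t = t ^ (β - 1) / Real.Gamma β - μ * mlKernel ρ (β + ρ) μ t := by
  rw [mlKernel, mittagLeffler_eq_add hρ hβ, mlKernel,
    show β + ρ - 1 = β - 1 + ρ by ring, Real.rpow_add ht]
  ring

theorem intervalIntegrable_mlKernel (hρ : ρ ∈ Ioo (0 : ℝ) 1) (hβ : 0 < β) (μ t : ℝ) :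
    IntervalIntegrable (mlKernel ρ β μ) volume 0 t :=
  (intervalIntegral.intervalIntegrable_rpow' (by linarith)).mul_continuousOn
    (continuous_mittagLeffler_rpow hρ hβ μ).continuousOn

theorem hasDerivAt_mlKernel_add_one (hρ : ρ ∈ Ioo (0 : ℝ) 1) (hβ : 0 < β) (μ : ℝ) {t : ℝ}
    (ht : 0 < t) : HasDerivAt (mlKernel ρ (β + 1) μ) (mlKernel ρ β μ t) t := by
  have hmeas : StronglyMeasurableAtFilter (mlKernel ρ β μ) (𝓝 t) :=
    (continuousOn_mlKernel hρ hβ μ).stronglyMeasurableAtFilter isOpen_Ioi t ht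
  refine (intervalIntegral.integral_hasDerivAt_right (intervalIntegrable_mlKernel hρ hβ μ t)
    hmeas ((continuousOn_mlKernel hρ hβ μ).continuousAt (Ioi_mem_nhds ht))).congr_of_eventuallyEq ?_
  filter_upwards [Ioi_mem_nhds ht] with s hs
  simpa using (integral_rpow_mul_mlKernel hρ one_pos hβ μ hs).symm

/-- The relaxation function `E_{ρ,1}(-μ t ^ ρ)` has derivative `-μ t ^ (ρ - 1) E_{ρ,ρ}(-μ t ^ ρ)`. -/
theorem hasDerivAt_mlKernel_one (hρ : ρ ∈ Ioo (0 : ℝ) 1) (μ : ℝ) {t : ℝ} (ht : 0 < t) :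
    HasDerivAt (mlKernel ρ 1 μ) (-(μ * mlKernel ρ ρ μ t)) t := by
  have h := ((hasDerivAt_mlKernel_add_one hρ hρ.1 μ ht).const_mul μ).const_sub 1
  refine h.congr_of_eventuallyEq ?_
  filter_upwards [Ioi_mem_nhds ht] with s hs
  rw [mlKernel_eq_sub hρ one_pos μ hs, add_comm 1 ρ]
  simp

/-! ### Positivity -/

/-- At the first zero `t₀` of `E_{ρ,ρ}(-t ^ ρ)`, the Volterra equation satisfied by this function is
contradicted, since its normalized kernel `(t / (t - s)) ^ (1 - ρ)` decreases in `t`. -/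
theorem mittagLeffler_pos (hρ : ρ ∈ Ioo (0 : ℝ) 1) {x : ℝ} (hx : 0 ≤ x) :
    0 < mittagLeffler ρ ρ (-x) := by
  have hρ0 := hρ.1
  have hΓ := Real.Gamma_pos_of_pos hρ0
  set p : ℝ → ℝ := fun t => mittagLeffler ρ ρ (-(1 * t ^ ρ)) with hp
  have hpc : Continuous p := continuous_mittagLeffler_rpow hρ hρ0 1
  set J : ℝ → ℝ → ℝ → ℝ := fun t a b =>
    t ^ (1 - ρ) * ∫ s in a..b, (t - s) ^ (ρ - 1) * mlKernel ρ ρ 1 s with hJ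
  -- The Volterra equation, multiplied by `Γ(ρ) t ^ (1 - ρ)`.
  have hvol : ∀ t, 0 < t → Real.Gamma ρ * p t = 1 - J t 0 t := by
    intro t ht
    have h1 := mlKernel_eq_sub hρ hρ0 1 ht
    have h2 := integral_rpow_mul_mlKernel hρ hρ0 hρ0 1 ht
    have h3 : t ^ (1 - ρ) * t ^ (ρ - 1) = 1 := by rw [← Real.rpow_add ht]; simp
    simp only [hJ, h2]
    have h4 : mlKernel ρ ρ 1 t = t ^ (ρ - 1) * p t := rfl
    rw [h4] at h1
    have h5 : mlKernel ρ (ρ + ρ) 1 t = t ^ (ρ - 1) / Real.Gamma ρ - t ^ (ρ - 1) * p t := by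
      linarith
    rw [h5]
    field_simp
    linear_combination (1 - p t * Real.Gamma ρ) * h3
  by_contra hneg
  rw [not_lt] at hneg
  set b := x ^ ρ⁻¹ with hb
  have hb0 : 0 ≤ b := Real.rpow_nonneg hx _
  have hpb : p b ≤ 0 := by simpa [hp, hb, ← Real.rpow_mul hx, inv_mul_cancel₀ hρ0.ne'] using hneg
  obtain ⟨t₀, ⟨⟨ht₀', ht₀b⟩, hpt₀⟩, hleast⟩ :=
    (isCompact_Icc.inter_right (isClosed_Iic.preimage hpc)).exists_isLeast
      ⟨b, ⟨hb0, le_rfl⟩, hpb⟩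
  have hmin : ∀ s, 0 ≤ s → s < t₀ → 0 < p s := by
    intro s hs hst
    by_contra h
    exact absurd (hleast ⟨⟨hs, hst.le.trans ht₀b⟩, not_lt.1 h⟩) (not_le.2 hst)
  have hpt₀' : p t₀ ≤ 0 := hpt₀
  have ht₀ : 0 < t₀ := by
    rcases ht₀'.eq_or_lt with h | h
    · rw [← h] at hpt₀'
      have : p 0 = (Real.Gamma ρ)⁻¹ := by
        simp [hp, Real.zero_rpow hρ0.ne', mittagLeffler_zero hρ hρ0]
      have := inv_pos.2 hΓ
      linarith
    · exact h
  -- A left neighbourhood of `t₀` on which the kernel has small mass.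
  have hbeta := intervalIntegrable_beta hρ0 hρ0 ht₀
  obtain ⟨t₁, ht₁, ht₁small⟩ : ∃ t₁ ∈ Ioo 0 t₀,
      t₀ ^ (1 - ρ) * ∫ s in t₁..t₀, (t₀ - s) ^ (ρ - 1) * s ^ (ρ - 1) < Real.Gamma ρ := by
    have hc := intervalIntegral.continuousOn_primitive_interval' hbeta right_mem_uIcc t₀
      right_mem_uIcc
    have hc2 : Tendsto (fun t₁ => t₀ ^ (1 - ρ) *
        -∫ s in t₀..t₁, (t₀ - s) ^ (ρ - 1) * s ^ (ρ - 1)) (𝓝[Ioo 0 t₀] t₀) (𝓝 0) := by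
      have h := (hc.tendsto.mono_left (nhdsWithin_mono _
        (Ioo_subset_Icc_self.trans (uIcc_of_le ht₀.le).ge))).neg.const_mul (t₀ ^ (1 - ρ))
      simpa using h
    have : (𝓝[Ioo 0 t₀] t₀).NeBot := by
      rw [nhdsWithin_Ioo_eq_nhdsLT ht₀]; infer_instance
    obtain ⟨t₁, h1, h2⟩ := ((hc2.eventually (gt_mem_nhds hΓ)).and self_mem_nhdsWithin).exists
    exact ⟨t₁, h2, by rwa [intervalIntegral.integral_symm]⟩
  -- At a maximum point `t` of `p` on `[t₁, t₀]` the contribution of `[t, t₀]` to the integral is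
  -- at most `p t` times the mass of the kernel there, which is less than `Γ(ρ) p t`.
  obtain ⟨t, ⟨ht₁t, htt₀⟩, hmax⟩ :=
    isCompact_Icc.exists_isMaxOn (nonempty_Icc.2 ht₁.2.le) hpc.continuousOn (s := Icc t₁ t₀)
  have hpt : 0 < p t := (hmin t₁ ht₁.1.le ht₁.2).trans_le (hmax (left_mem_Icc.2 ht₁.2.le))
  have htt₀' : t < t₀ := lt_of_le_of_ne htt₀ (by rintro rfl; linarith)
  have ht : 0 < t := ht₁.1.trans_le ht₁t
  have hker : ∀ s, 0 < s → s < t₀ → 0 ≤ mlKernel ρ ρ 1 s := fun s hs hst =>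
    mul_nonneg (Real.rpow_nonneg hs.le _) (hmin s hs.le hst).le
  have hint₀ := intervalIntegrable_rpow_mul_mlKernel hρ hρ0 hρ0 1 ht₀
  have hsub1 : uIcc 0 t ⊆ uIcc 0 t₀ := by
    rw [uIcc_of_le ht.le, uIcc_of_le ht₀.le]; exact Icc_subset_Icc_right htt₀
  have hsub2 : uIcc t t₀ ⊆ uIcc 0 t₀ := by
    rw [uIcc_of_le htt₀, uIcc_of_le ht₀.le]; exact Icc_subset_Icc_left ht.le
  have hsub3 : uIcc t₁ t₀ ⊆ uIcc 0 t₀ := by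
    rw [uIcc_of_le ht₁.2.le, uIcc_of_le ht₀.le]; exact Icc_subset_Icc_left ht₁.1.le
  have hsplit : J t₀ 0 t₀ = J t₀ 0 t + J t₀ t t₀ := by
    simp only [hJ]
    rw [← mul_add, intervalIntegral.integral_add_adjacent_intervals (hint₀.mono_set hsub1)
      (hint₀.mono_set hsub2)]
  have hfirst : J t₀ 0 t ≤ J t 0 t := by
    simp only [hJ]
    rw [← intervalIntegral.integral_const_mul, ← intervalIntegral.integral_const_mul]
    refine intervalIntegral.integral_mono_on_of_le_Ioo ht.le
      ((hint₀.mono_set hsub1).const_mul _)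
      ((intervalIntegrable_rpow_mul_mlKernel hρ hρ0 hρ0 1 ht).const_mul _) fun s hs => ?_
    have hnorm : ∀ r, s < r → r ^ (1 - ρ) * (r - s) ^ (ρ - 1) = (1 - s / r) ^ (ρ - 1) := by
      intro r hr
      have hr0 : 0 < r := hs.1.trans hr
      rw [show 1 - s / r = (r - s) / r by field_simp, Real.div_rpow (sub_pos.2 hr).le hr0.le,
        show 1 - ρ = -(ρ - 1) by ring, Real.rpow_neg hr0.le]
      ring
    rw [← mul_assoc, ← mul_assoc, hnorm t₀ (hs.2.trans htt₀'), hnorm t hs.2]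
    refine mul_le_mul_of_nonneg_right ?_ (hker s hs.1 (hs.2.trans htt₀'))
    refine Real.rpow_le_rpow_of_nonpos ?_ ?_ (by linarith [hρ.2])
    · rw [sub_pos, div_lt_one ht]; exact hs.2
    · have := hs.1.le
      gcongr
  have hsecond : J t₀ t t₀ ≤
      p t * (t₀ ^ (1 - ρ) * ∫ s in t₁..t₀, (t₀ - s) ^ (ρ - 1) * s ^ (ρ - 1)) := by
    have h1 : ∫ s in t..t₀, (t₀ - s) ^ (ρ - 1) * mlKernel ρ ρ 1 s ≤
        ∫ s in t..t₀, p t * ((t₀ - s) ^ (ρ - 1) * s ^ (ρ - 1)) := by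
      refine intervalIntegral.integral_mono_on_of_le_Ioo htt₀ (hint₀.mono_set hsub2)
        ((hbeta.mono_set hsub2).const_mul _) fun s hs => ?_
      have h2 : p s ≤ p t := hmax ⟨ht₁t.trans hs.1.le, hs.2.le⟩
      have h3 : 0 ≤ (t₀ - s) ^ (ρ - 1) := Real.rpow_nonneg (sub_nonneg.2 hs.2.le) _
      have h4 : 0 ≤ s ^ (ρ - 1) := Real.rpow_nonneg (ht.trans hs.1).le _
      calc (t₀ - s) ^ (ρ - 1) * mlKernel ρ ρ 1 s
          = (t₀ - s) ^ (ρ - 1) * (s ^ (ρ - 1) * p s) := rfl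
        _ ≤ (t₀ - s) ^ (ρ - 1) * (s ^ (ρ - 1) * p t) := by gcongr
        _ = _ := by ring
    rw [intervalIntegral.integral_const_mul] at h1
    have h5 : ∫ s in t..t₀, (t₀ - s) ^ (ρ - 1) * s ^ (ρ - 1) ≤
        ∫ s in t₁..t₀, (t₀ - s) ^ (ρ - 1) * s ^ (ρ - 1) := by
      refine intervalIntegral.integral_mono_interval ht₁t htt₀ le_rfl ?_ (hbeta.mono_set hsub3)
      refine (ae_restrict_iff' measurableSet_Ioc).2 (Eventually.of_forall fun s hs => ?_)
      exact mul_nonneg (Real.rpow_nonneg (sub_nonneg.2 hs.2) _)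
        (Real.rpow_nonneg (ht₁.1.trans hs.1).le _)
    have h6 : 0 ≤ t₀ ^ (1 - ρ) := Real.rpow_nonneg ht₀.le _
    calc J t₀ t t₀ ≤ t₀ ^ (1 - ρ) *
          (p t * ∫ s in t..t₀, (t₀ - s) ^ (ρ - 1) * s ^ (ρ - 1)) := by
            simp only [hJ]; gcongr
      _ ≤ t₀ ^ (1 - ρ) *
          (p t * ∫ s in t₁..t₀, (t₀ - s) ^ (ρ - 1) * s ^ (ρ - 1)) := by gcongr
      _ = _ := by ring
  have h1 := hvol t ht
  have h2 := hvol t₀ ht₀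
  have h3 : Real.Gamma ρ * p t₀ ≤ 0 := mul_nonpos_of_nonneg_of_nonpos hΓ.le hpt₀'
  have h4 := mul_lt_mul_of_pos_left ht₁small hpt
  linarith

theorem mlKernel_self_nonneg (hρ : ρ ∈ Ioo (0 : ℝ) 1) {μ : ℝ} (hμ : 0 ≤ μ) {t : ℝ} (ht : 0 ≤ t) :
    0 ≤ mlKernel ρ ρ μ t :=
  mul_nonneg (Real.rpow_nonneg ht _)
    (mittagLeffler_pos hρ (mul_nonneg hμ (Real.rpow_nonneg ht _))).le

theorem mlKernel_one_eq (μ t : ℝ) : mlKernel ρ 1 μ t = mittagLeffler ρ 1 (-(μ * t ^ ρ)) := by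
  simp [mlKernel]

theorem continuous_mlKernel_one (hρ : ρ ∈ Ioo (0 : ℝ) 1) (μ : ℝ) :
    Continuous (mlKernel ρ 1 μ) := by
  simp only [funext (mlKernel_one_eq (ρ := ρ) μ)]
  exact continuous_mittagLeffler_rpow hρ one_pos μ

theorem mlKernel_one_zero (hρ : ρ ∈ Ioo (0 : ℝ) 1) (μ : ℝ) : mlKernel ρ 1 μ 0 = 1 := by
  simp [mlKernel_one_eq, Real.zero_rpow hρ.1.ne', mittagLeffler_zero hρ one_pos]

theorem measurable_mlKernel (hρ : ρ ∈ Ioo (0 : ℝ) 1) (hβ : 0 < β) (μ : ℝ) :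
    Measurable (mlKernel ρ β μ) :=
  (measurable_id.pow_const _).mul (continuous_mittagLeffler_rpow hρ hβ μ).measurable

theorem integral_rpow_mul_mlKernel_self (hρ : ρ ∈ Ioo (0 : ℝ) 1) (μ : ℝ) {t : ℝ} (ht : 0 < t) :
    ∫ s in (0 : ℝ)..t, (t - s) ^ (1 - ρ - 1) * mlKernel ρ ρ μ s =
      Real.Gamma (1 - ρ) * mlKernel ρ 1 μ t := by
  rw [integral_rpow_mul_mlKernel hρ (sub_pos.2 hρ.2) hρ.1 μ ht, add_sub_cancel]

theorem mlKernel_one_nonneg (hρ : ρ ∈ Ioo (0 : ℝ) 1) {μ : ℝ} (hμ : 0 ≤ μ) {t : ℝ} (ht : 0 ≤ t) :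
    0 ≤ mlKernel ρ 1 μ t := by
  rcases ht.eq_or_lt with rfl | ht
  · simp [mlKernel_one_zero hρ]
  have h : 0 ≤ ∫ s in (0 : ℝ)..t, (t - s) ^ (1 - ρ - 1) * mlKernel ρ ρ μ s :=
    intervalIntegral.integral_nonneg ht.le fun s hs =>
      mul_nonneg (Real.rpow_nonneg (sub_nonneg.2 hs.2) _) (mlKernel_self_nonneg hρ hμ hs.1)
  rw [integral_rpow_mul_mlKernel_self hρ μ ht] at h
  exact nonneg_of_mul_nonneg_right h (Real.Gamma_pos_of_pos (sub_pos.2 hρ.2))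

/-! ### The Duhamel formula -/

section Duhamel

variable {E : Type*} [NormedAddCommGroup E] [NormedSpace ℝ E]

theorem fracIntegrand_eq {h : ℝ → E} {t ξ : ℝ} (hξ : ξ ≤ t) :
    fracIntegrand (ρ - 1) h t ξ = (t - ξ) ^ (1 - ρ - 1) • h ξ := by
  rw [fracIntegrand, ← Real.rpow_neg (sub_nonneg.2 hξ)]
  ring_nf

theorem fracIntegral_eq (h : ℝ → E) {t : ℝ} (ht : 0 ≤ t) :
    fracIntegral (ρ - 1) h t =
      (Real.Gamma (1 - ρ))⁻¹ • ∫ s in (0 : ℝ)..t, (t - s) ^ (1 - ρ - 1) • h s := by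
  rw [fracIntegral, neg_sub]
  congr 1
  refine intervalIntegral.integral_congr fun s hs => ?_
  rw [uIcc_of_le ht] at hs
  exact fracIntegrand_eq hs.2

theorem HasFracIntegral.intervalIntegrable {y : ℝ → E} {t : ℝ} (hρ : ρ ∈ Ioo (0 : ℝ) 1)
    (ht : 0 < t) (h : HasFracIntegral (ρ - 1) y t) : IntervalIntegrable y volume 0 t := by
  have hc : Continuous fun s : ℝ => (t - s) ^ ρ :=
    (Real.continuous_rpow_const hρ.1.le).comp (continuous_const.sub continuous_id)
  refine (IntervalIntegrable.continuousOn_smul h hc.continuousOn).congr_ae ?_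
  have hne : ∀ᵐ s ∂(volume : Measure ℝ), s ≠ t := by simp [ae_iff]
  refine (ae_restrict_iff' measurableSet_uIoc).2 (hne.mono fun s hst hs => ?_)
  rw [uIoc_of_le ht.le] at hs
  have : 0 < t - s := sub_pos.2 (lt_of_le_of_ne hs.2 hst)
  simp only [fracIntegrand]
  rw [smul_smul, sub_add_cancel, mul_inv_cancel₀ (Real.rpow_pos_of_pos this _).ne', one_smul]

theorem intervalIntegrable_mlKernel_mul_rpow (hρ : ρ ∈ Ioo (0 : ℝ) 1) (μ : ℝ) {r t : ℝ}
    (hrt : r < t) :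
    IntervalIntegrable (fun s => mlKernel ρ ρ μ (t - s) * (s - r) ^ (1 - ρ - 1)) volume r t := by
  have h := (intervalIntegrable_rpow_mul_mlKernel hρ (sub_pos.2 hρ.2) hρ.1 μ
    (sub_pos.2 hrt)).comp_sub_left t
  simp only [sub_zero, sub_sub_cancel] at h
  refine h.symm.congr fun s _ => ?_
  simp only [mul_comm (mlKernel _ _ _ _)]
  congr 2; ring

theorem integral_mlKernel_mul_rpow (hρ : ρ ∈ Ioo (0 : ℝ) 1) (μ : ℝ) {r t : ℝ} (hrt : r < t) :
    ∫ s in r..t, mlKernel ρ ρ μ (t - s) * (s - r) ^ (1 - ρ - 1) =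
      Real.Gamma (1 - ρ) * mlKernel ρ 1 μ (t - r) := by
  rw [← integral_rpow_mul_mlKernel_self hρ μ (sub_pos.2 hrt)]
  have h := intervalIntegral.integral_comp_sub_left (a := r) (b := t)
    (fun s => (t - r - s) ^ (1 - ρ - 1) * mlKernel ρ ρ μ s) t
  rw [sub_self] at h
  rw [← h]
  refine intervalIntegral.integral_congr fun s _ => ?_
  simp only [mul_comm (mlKernel _ _ _ _)]
  congr 2; ring

/-- Associativity of convolution for the kernel `t ^ (ρ - 1) E_{ρ,ρ}(-μ t ^ ρ)`, the fractional
integral and `y`. -/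
theorem integral_mlKernel_smul_fracIntegral [CompleteSpace E] (hρ : ρ ∈ Ioo (0 : ℝ) 1) {μ : ℝ}
    (hμ : 0 ≤ μ) {y : ℝ → E} {t : ℝ} (ht : 0 < t) (hy : IntervalIntegrable y volume 0 t) :
    IntervalIntegrable (fun s => mlKernel ρ ρ μ (t - s) • fracIntegral (ρ - 1) y s) volume 0 t ∧
    ∫ s in (0 : ℝ)..t, mlKernel ρ ρ μ (t - s) • fracIntegral (ρ - 1) y s =
      ∫ s in (0 : ℝ)..t, mlKernel ρ 1 μ (t - s) • y s := by
  have hΓ := Real.Gamma_pos_of_pos (sub_pos.2 hρ.2)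
  set m := (volume : Measure ℝ).restrict (Ioc 0 t) with hm
  -- The scalar part of the double integrand, supported on `r < s`; it is nonnegative, so its
  -- integrability on the square follows from that of its integral in `s`.
  set W : ℝ → ℝ → ℝ := fun s r =>
    (Ioi r).indicator (fun s => mlKernel ρ ρ μ (t - s) * (s - r) ^ (1 - ρ - 1)) s with hW
  have hy' : Integrable y m := (intervalIntegrable_iff_integrableOn_Ioc_of_le ht.le).1 hy
  have hWmeas : Measurable (Function.uncurry W) := by
    have : Function.uncurry W = {q : ℝ × ℝ | q.2 < q.1}.indicator
        (fun q => mlKernel ρ ρ μ (t - q.1) * (q.1 - q.2) ^ (1 - ρ - 1)) := by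
      ext ⟨s, r⟩
      simp [hW, Function.uncurry, indicator]
    rw [this]
    refine Measurable.indicator ?_ (measurableSet_lt measurable_snd measurable_fst)
    exact ((measurable_mlKernel hρ hρ.1 μ).comp (measurable_const.sub measurable_fst)).mul
      ((measurable_fst.sub measurable_snd).pow_const _)
  have hW0 : ∀ r s, s ≤ t → 0 ≤ W s r := by
    intro r s hs
    simp only [hW]
    refine indicator_apply_nonneg fun hrs => ?_
    exact mul_nonneg (mlKernel_self_nonneg hρ hμ (sub_nonneg.2 hs))
      (Real.rpow_nonneg (sub_pos.2 hrs).le _)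
  have hmem : ∀ᵐ s ∂m, s ∈ Ioo 0 t := by
    rw [hm, Measure.restrict_congr_set Ioo_ae_eq_Ioc.symm]
    exact ae_restrict_mem measurableSet_Ioo
  have hinter : ∀ r ∈ Ioo 0 t, Ioi r ∩ Ioc 0 t = Ioc r t := by
    intro r hr
    ext s
    simp only [mem_inter_iff, mem_Ioi, mem_Ioc]
    exact ⟨fun h => ⟨h.1, h.2.2⟩, fun h => ⟨h.1, hr.1.trans h.1, h.2⟩⟩
  have hWint : ∀ r ∈ Ioo 0 t, Integrable (fun s => W s r) m := by
    intro r hr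
    rw [hm]
    simp only [hW]
    rw [integrable_indicator_iff measurableSet_Ioi, IntegrableOn,
      Measure.restrict_restrict measurableSet_Ioi, hinter r hr]
    exact (intervalIntegrable_iff_integrableOn_Ioc_of_le hr.2.le).1
      (intervalIntegrable_mlKernel_mul_rpow hρ μ hr.2)
  have hWval : ∀ r ∈ Ioo 0 t, ∫ s, W s r ∂m = Real.Gamma (1 - ρ) * mlKernel ρ 1 μ (t - r) := by
    intro r hr
    rw [hm]
    simp only [hW]
    rw [integral_indicator measurableSet_Ioi, Measure.restrict_restrict measurableSet_Ioi,
      hinter r hr, ← intervalIntegral.integral_of_le hr.2.le, integral_mlKernel_mul_rpow hρ μ hr.2]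
  have hFc : Continuous fun r => mlKernel ρ 1 μ (t - r) :=
    (continuous_mlKernel_one hρ μ).comp (continuous_const.sub continuous_id)
  have hint : Integrable (Function.uncurry fun s r => W s r • y r) (m.prod m) := by
    have hmeas : AEStronglyMeasurable (Function.uncurry fun s r => W s r • y r) (m.prod m) :=
      hWmeas.aestronglyMeasurable.smul hy'.1.comp_snd
    rw [integrable_prod_iff' hmeas]
    refine ⟨hmem.mono fun r hr => (hWint r hr).smul_const (y r), ?_⟩
    have h1 : Integrable (fun r => (Real.Gamma (1 - ρ) * mlKernel ρ 1 μ (t - r)) * ‖y r‖) m := by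
      refine (intervalIntegrable_iff_integrableOn_Ioc_of_le ht.le).1 ?_
      exact hy.norm.continuousOn_mul (continuous_const.mul hFc).continuousOn
    refine h1.congr (hmem.mono fun r hr => ?_)
    simp only [Function.uncurry, norm_smul]
    rw [integral_mul_const, ← hWval r hr]
    congr 1
    refine integral_congr_ae (hmem.mono fun s hs => ?_)
    simp only
    rw [Real.norm_of_nonneg (hW0 r s hs.2.le)]
  have hinner : ∀ s ∈ Ioo 0 t, ∫ r, W s r • y r ∂m =
      Real.Gamma (1 - ρ) • (mlKernel ρ ρ μ (t - s) • fracIntegral (ρ - 1) y s) := by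
    intro s hs
    have h1 : ∀ r, W s r • y r = (Iio s).indicator
        (fun r => mlKernel ρ ρ μ (t - s) • ((s - r) ^ (1 - ρ - 1) • y r)) r := by
      intro r
      simp only [hW, indicator, mem_Ioi, mem_Iio]
      split_ifs <;> simp [mul_smul]
    have h2 : Iio s ∩ Ioc 0 t = Ioo 0 s := by
      ext r
      simp only [mem_inter_iff, mem_Iio, mem_Ioo, mem_Ioc]
      exact ⟨fun h => ⟨h.2.1, h.1⟩, fun h => ⟨h.2, h.1, (h.2.trans hs.2).le⟩⟩
    simp only [h1]
    rw [integral_indicator measurableSet_Iio, hm, Measure.restrict_restrict measurableSet_Iio, h2,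
      Measure.restrict_congr_set Ioo_ae_eq_Ioc, integral_smul, fracIntegral_eq y hs.1.le,
      ← intervalIntegral.integral_of_le hs.1.le, smul_comm, smul_inv_smul₀ hΓ.ne']
  have hI1 : Integrable (fun s => mlKernel ρ ρ μ (t - s) • fracIntegral (ρ - 1) y s) m := by
    refine (hint.integral_prod_left.smul (Real.Gamma (1 - ρ))⁻¹).congr (hmem.mono fun s hs => ?_)
    simp only [Pi.smul_apply, Function.uncurry]
    rw [hinner s hs, inv_smul_smul₀ hΓ.ne']
  refine ⟨(intervalIntegrable_iff_integrableOn_Ioc_of_le ht.le).2 hI1, ?_⟩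
  have hswap := integral_integral_swap hint
  rw [integral_congr_ae (hmem.mono hinner), integral_smul] at hswap
  have hright : ∫ r, ∫ s, W s r • y r ∂m ∂m =
      Real.Gamma (1 - ρ) • ∫ r, mlKernel ρ 1 μ (t - r) • y r ∂m := by
    rw [← integral_smul]
    refine integral_congr_ae (hmem.mono fun r hr => ?_)
    simp only
    rw [integral_smul_const, hWval r hr, mul_smul]
  rw [hright] at hswap
  have := congrArg ((Real.Gamma (1 - ρ))⁻¹ • ·) hswap
  simp only [inv_smul_smul₀ hΓ.ne'] at this
  rw [intervalIntegral.integral_of_le ht.le, intervalIntegral.integral_of_le ht.le]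
  exact this

/-- If `g = ∂_t^(ρ-1) y` satisfies `g' = -μ y`, then differentiating `E_{ρ,1}(-λ (t - s) ^ ρ) g(s)`
in `s` compares `g` with the solution `E_{ρ,1}(-λ t ^ ρ) g(0+)` of the same equation with `λ`. -/
theorem fracIntegral_sub_mlKernel_one_smul [CompleteSpace E] (hρ : ρ ∈ Ioo (0 : ℝ) 1)
    {lam μ : ℝ} (hlam : 0 ≤ lam) {y : ℝ → E} {t : ℝ} (ht : 0 < t)
    (hy : IntervalIntegrable y volume 0 t)
    (hderiv : ∀ s ∈ Ioo 0 t, HasDerivAt (fracIntegral (ρ - 1) y) (-(μ • y s)) s) {c d : E}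
    (hc : Tendsto (fracIntegral (ρ - 1) y) (𝓝[>] 0) (𝓝 c))
    (hd : Tendsto (fracIntegral (ρ - 1) y) (𝓝[<] t) (𝓝 d)) :
    d - mlKernel ρ 1 lam t • c = (lam - μ) • ∫ s in (0 : ℝ)..t, mlKernel ρ 1 lam (t - s) • y s := by
  obtain ⟨hint, heq⟩ := integral_mlKernel_smul_fracIntegral hρ hlam ht hy
  have hF := continuous_mlKernel_one hρ lam
  have hFt : Continuous fun s => mlKernel ρ 1 lam (t - s) :=
    hF.comp (continuous_const.sub continuous_id)
  have hint2 : IntervalIntegrable (fun s => mlKernel ρ 1 lam (t - s) • y s) volume 0 t :=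
    hy.continuousOn_smul hFt.continuousOn
  have hderiv2 : ∀ s ∈ Ioo 0 t,
      HasDerivAt (fun s => mlKernel ρ 1 lam (t - s) • fracIntegral (ρ - 1) y s)
        (lam • (mlKernel ρ ρ lam (t - s) • fracIntegral (ρ - 1) y s) -
          μ • (mlKernel ρ 1 lam (t - s) • y s)) s := by
    intro s hs
    have h1 := (hasDerivAt_mlKernel_one hρ lam (sub_pos.2 hs.2)).scomp s
      ((hasDerivAt_id s).const_sub t)
    have h2 := HasDerivAt.fun_smul h1 (hderiv s hs)
    refine h2.congr_deriv ?_
    simp only [Function.comp, smul_eq_mul, smul_smul, smul_neg]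
    rw [mul_comm μ]
    module
  have h0 : Tendsto (fun s => mlKernel ρ 1 lam (t - s) • fracIntegral (ρ - 1) y s) (𝓝[>] 0)
      (𝓝 (mlKernel ρ 1 lam t • c)) := by
    have := hFt.tendsto 0
    rw [sub_zero] at this
    exact (this.mono_left nhdsWithin_le_nhds).smul hc
  have h1 : Tendsto (fun s => mlKernel ρ 1 lam (t - s) • fracIntegral (ρ - 1) y s) (𝓝[<] t)
      (𝓝 d) := by
    have := hFt.tendsto t
    rw [sub_self, mlKernel_one_zero hρ] at this
    simpa using (this.mono_left nhdsWithin_le_nhds).smul hd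
  rw [← intervalIntegral.integral_eq_sub_of_hasDerivAt_of_tendsto ht hderiv2
    ((hint.smul lam).sub (hint2.smul μ)) h0 h1]
  refine (intervalIntegral.integral_sub (hint.smul lam) (hint2.smul μ)).trans ?_
  simp only [Pi.smul_apply]
  rw [intervalIntegral.integral_smul, intervalIntegral.integral_smul, heq, sub_smul]

/-- Every solution of the scalar equation is a multiple of `t ^ (ρ - 1) E_{ρ,ρ}(-λ t ^ ρ)`; the
factor is the limit at `0` of its fractional integral. -/
theorem exists_eq_mlKernel_smul [CompleteSpace E] (hρ : ρ ∈ Ioo (0 : ℝ) 1)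
    {lam : ℝ} (hlam : 0 < lam) {y : ℝ → E} {T : ℝ} (hT : 0 < T)
    (hy : ∀ t ∈ Ioo 0 T, HasFracIntegral (ρ - 1) y t)
    (hderiv : ∀ s ∈ Ioo 0 T, HasDerivAt (fracIntegral (ρ - 1) y) (-(lam • y s)) s) :
    ∃ c : E, ∀ t ∈ Ioo 0 T, fracIntegral (ρ - 1) y t = mlKernel ρ 1 lam t • c ∧
      y t = mlKernel ρ ρ lam t • c := by
  set g := fracIntegral (ρ - 1) y with hg
  have hyint : ∀ t ∈ Ioo 0 T, IntervalIntegrable y volume 0 t := fun t ht =>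
    (hy t ht).intervalIntegrable hρ ht.1
  -- `g' = -λ y` is integrable near `0`, so `g` has a limit there.
  obtain ⟨c, hc⟩ : ∃ c, Tendsto g (𝓝[>] 0) (𝓝 c) := by
    obtain ⟨b, hb0, hbT⟩ := exists_between hT
    have hyb := hyint b ⟨hb0, hbT⟩
    have hcont := (intervalIntegral.continuousOn_primitive_interval' hyb right_mem_uIcc 0
      left_mem_uIcc).tendsto.mono_left (nhdsWithin_mono 0
        (Ioo_subset_Icc_self.trans (uIcc_of_le hb0.le).ge))
    rw [nhdsWithin_Ioo_eq_nhdsGT hb0] at hcont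
    refine ⟨_, Tendsto.congr' ?_ ((hcont.const_smul (-lam)).const_add (g b))⟩
    filter_upwards [Ioo_mem_nhdsGT hb0] with s hs
    have hsub : uIcc s b ⊆ Ioo 0 T := by
      rw [uIcc_of_le hs.2.le]
      exact fun r hr => ⟨hs.1.trans_le hr.1, hr.2.trans_lt hbT⟩
    have hsub2 : uIcc b s ⊆ uIcc 0 b := by
      rw [uIcc_comm, uIcc_of_le hs.2.le, uIcc_of_le hb0.le]
      exact Icc_subset_Icc_left hs.1.le
    have h := intervalIntegral.integral_eq_sub_of_hasDerivAt (a := b) (b := s) (f := g)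
      (f' := fun r => -(lam • y r)) (fun r hr => hderiv r (hsub (by rwa [uIcc_comm])))
      ((hyb.mono_set hsub2).smul lam).neg
    rw [intervalIntegral.integral_neg, intervalIntegral.integral_smul] at h
    rw [neg_smul, h]
    abel
  have hgF : ∀ t ∈ Ioo 0 T, g t = mlKernel ρ 1 lam t • c := by
    intro t ht
    have h := fracIntegral_sub_mlKernel_one_smul (μ := lam) hρ hlam.le ht.1 (hyint t ht)
      (fun s hs => hderiv s ⟨hs.1, hs.2.trans ht.2⟩) hc
      ((hderiv t ht).continuousAt.tendsto.mono_left nhdsWithin_le_nhds)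
    rwa [sub_self, zero_smul, sub_eq_zero] at h
  refine ⟨c, fun t ht => ⟨hgF t ht, ?_⟩⟩
  have h1 : HasDerivAt g (-(lam * mlKernel ρ ρ lam t) • c) t := by
    refine ((hasDerivAt_mlKernel_one hρ lam ht.1).smul_const c).congr_of_eventuallyEq ?_
    filter_upwards [Ioo_mem_nhds ht.1 ht.2] with s hs using hgF s hs
  have h2 := (hderiv t ht).unique h1
  rw [neg_smul, neg_inj, mul_smul] at h2
  exact smul_right_injective E hlam.ne' h2

end Duhamel

/-! ### Convexity and two-sided bounds -/

theorem fracIntegral_mlKernel_self (hρ : ρ ∈ Ioo (0 : ℝ) 1) (μ : ℝ) {t : ℝ} (ht : 0 < t) :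
    fracIntegral (ρ - 1) (mlKernel ρ ρ μ) t = mlKernel ρ 1 μ t := by
  rw [fracIntegral_eq _ ht.le]
  simp only [smul_eq_mul]
  rw [integral_rpow_mul_mlKernel_self hρ μ ht,
    inv_mul_cancel_left₀ (Real.Gamma_pos_of_pos (sub_pos.2 hρ.2)).ne']

/-- The difference quotients of `x ↦ E_{ρ,1}(-x)`, as integrals of positive functions. -/
theorem mittagLeffler_one_sub (hρ : ρ ∈ Ioo (0 : ℝ) 1) {x : ℝ} (hx : 0 ≤ x) (z : ℝ) :
    mittagLeffler ρ 1 (-z) - mittagLeffler ρ 1 (-x) =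
      (x - z) * ∫ s in (0 : ℝ)..1, mlKernel ρ 1 x (1 - s) * mlKernel ρ ρ z s := by
  have hF := continuous_mlKernel_one hρ z
  have heq : ∀ᶠ s in 𝓝[>] (0 : ℝ), mlKernel ρ 1 z s = fracIntegral (ρ - 1) (mlKernel ρ ρ z) s := by
    filter_upwards [self_mem_nhdsWithin] with s hs
    exact (fracIntegral_mlKernel_self hρ z hs).symm
  have heq2 : ∀ᶠ s in 𝓝[<] (1 : ℝ), mlKernel ρ 1 z s =
      fracIntegral (ρ - 1) (mlKernel ρ ρ z) s := by
    filter_upwards [Ioo_mem_nhdsLT one_pos] with s hs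
    exact (fracIntegral_mlKernel_self hρ z hs.1).symm
  have h := fracIntegral_sub_mlKernel_one_smul (μ := z) hρ hx one_pos
    (intervalIntegrable_mlKernel hρ hρ.1 z 1) (fun s hs => ?_)
    (((hF.tendsto 0).mono_left nhdsWithin_le_nhds).congr' heq)
    (((hF.tendsto 1).mono_left nhdsWithin_le_nhds).congr' heq2)
  · simpa [mlKernel_one_zero hρ, mlKernel_one_eq (ρ := ρ) z 1,
      mlKernel_one_eq (ρ := ρ) x 1] using h
  · refine (hasDerivAt_mlKernel_one hρ z hs.1).congr_of_eventuallyEq ?_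
    filter_upwards [Ioi_mem_nhds hs.1] with r hr using fracIntegral_mlKernel_self hρ z hr

theorem mittagLeffler_one_antitoneOn (hρ : ρ ∈ Ioo (0 : ℝ) 1) :
    AntitoneOn (fun x => mittagLeffler ρ 1 (-x)) (Ici 0) := by
  intro x hx z hz hxz
  have h := mittagLeffler_one_sub hρ (x := z) hz x
  have : 0 ≤ ∫ s in (0 : ℝ)..1, mlKernel ρ 1 z (1 - s) * mlKernel ρ ρ x s :=
    intervalIntegral.integral_nonneg zero_le_one fun s hs =>
      mul_nonneg (mlKernel_one_nonneg hρ hz (sub_nonneg.2 hs.2)) (mlKernel_self_nonneg hρ hx hs.1)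
  have := mul_nonneg (sub_nonneg.2 hxz) this
  simp only
  linarith

theorem mlKernel_one_le (hρ : ρ ∈ Ioo (0 : ℝ) 1) {x z s t : ℝ} (hx : 0 ≤ x) (hxz : x ≤ z)
    (hs : 0 ≤ s) (hst : s ≤ t) : mlKernel ρ 1 z t ≤ mlKernel ρ 1 x s := by
  rw [mlKernel_one_eq, mlKernel_one_eq]
  have hsρ := Real.rpow_nonneg hs ρ
  have htρ := Real.rpow_nonneg (hs.trans hst) ρ
  have hρ0 := hρ.1.le
  have hz := hx.trans hxz
  exact mittagLeffler_one_antitoneOn hρ (mul_nonneg hx hsρ) (mul_nonneg hz htρ)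
    (by gcongr)

theorem mlKernel_one_le_one (hρ : ρ ∈ Ioo (0 : ℝ) 1) {x t : ℝ} (hx : 0 ≤ x) (ht : 0 ≤ t) :
    mlKernel ρ 1 x t ≤ 1 :=
  (mlKernel_one_le hρ hx le_rfl le_rfl ht).trans_eq (mlKernel_one_zero hρ x)

theorem convexOn_mittagLeffler_one (hρ : ρ ∈ Ioo (0 : ℝ) 1) :
    ConvexOn ℝ (Ici 0) fun x => mittagLeffler ρ 1 (-x) := by
  refine convexOn_of_slope_mono_adjacent (convex_Ici 0) fun {x y z} hx hz hxy hyz => ?_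
  have hx : 0 ≤ x := hx
  have hz : 0 ≤ z := hz
  have hy : 0 ≤ y := hx.trans hxy.le
  have h1 := mittagLeffler_one_sub hρ hx y
  have h2 := mittagLeffler_one_sub hρ hz y
  have hint : ∀ w, IntervalIntegrable (fun s => mlKernel ρ 1 w (1 - s) * mlKernel ρ ρ y s)
      volume 0 1 := fun w =>
    (intervalIntegrable_mlKernel hρ hρ.1 y 1).continuousOn_mul
      ((continuous_mlKernel_one hρ w).comp (continuous_const.sub continuous_id)).continuousOn
  have hmono : ∫ s in (0 : ℝ)..1, mlKernel ρ 1 z (1 - s) * mlKernel ρ ρ y s ≤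
      ∫ s in (0 : ℝ)..1, mlKernel ρ 1 x (1 - s) * mlKernel ρ ρ y s :=
    intervalIntegral.integral_mono_on zero_le_one (hint z) (hint x) fun s hs =>
      mul_le_mul_of_nonneg_right
        (mlKernel_one_le hρ hx (hxy.trans hyz).le (sub_nonneg.2 hs.2) le_rfl)
        (mlKernel_self_nonneg hρ hy hs.1)
  have h3 : (mittagLeffler ρ 1 (-y) - mittagLeffler ρ 1 (-x)) / (y - x) =
      -∫ s in (0 : ℝ)..1, mlKernel ρ 1 x (1 - s) * mlKernel ρ ρ y s := by
    rw [h1, div_eq_iff (sub_pos.2 hxy).ne']; ring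
  have h4 : (mittagLeffler ρ 1 (-z) - mittagLeffler ρ 1 (-y)) / (z - y) =
      -∫ s in (0 : ℝ)..1, mlKernel ρ 1 z (1 - s) * mlKernel ρ ρ y s := by
    rw [div_eq_iff (sub_pos.2 hyz).ne']; linarith
  rw [h3, h4]
  exact neg_le_neg hmono

/-- Obtained from `F' = -e` in the time variable by substituting `t = x ^ ρ⁻¹`. -/
theorem hasDerivAt_mittagLeffler_one (hρ : ρ ∈ Ioo (0 : ℝ) 1) {x : ℝ} (hx : 0 < x) :
    HasDerivAt (fun x => mittagLeffler ρ 1 (-x)) (-(mittagLeffler ρ ρ (-x) / ρ)) x := by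
  have hρ0 := hρ.1
  have h := (hasDerivAt_mlKernel_one hρ 1 (Real.rpow_pos_of_pos hx ρ⁻¹)).comp x
    (Real.hasDerivAt_rpow_const (p := ρ⁻¹) (Or.inl hx.ne'))
  have hinv : ∀ s : ℝ, 0 < s → (s ^ ρ⁻¹) ^ ρ = s := fun s hs => by
    rw [← Real.rpow_mul hs.le, inv_mul_cancel₀ hρ0.ne', Real.rpow_one]
  refine (h.congr_of_eventuallyEq ?_).congr_deriv ?_
  · filter_upwards [Ioi_mem_nhds hx] with s hs
    simp [mlKernel_one_eq, hinv s hs]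
  · have h1 : (x ^ ρ⁻¹) ^ (ρ - 1) * x ^ (ρ⁻¹ - 1) = 1 := by
      rw [← Real.rpow_mul hx.le, ← Real.rpow_add hx]
      rw [show ρ⁻¹ * (ρ - 1) + (ρ⁻¹ - 1) = 0 by field_simp; ring, Real.rpow_zero]
    simp only [mlKernel, hinv x hx, one_mul]
    linear_combination (-mittagLeffler ρ ρ (-x) * ρ⁻¹) * h1

/-- With `J^α` the Riemann-Liouville integral of order `α > 0`: in `F = 1 - x J^ρ F` at time `1`, the
decreasing function `F = mlKernel ρ 1 x` is replaced by its final value. -/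
theorem mul_mittagLeffler_one_le (hρ : ρ ∈ Ioo (0 : ℝ) 1) {x : ℝ} (hx : 0 ≤ x) :
    x * mittagLeffler ρ 1 (-x) ≤ Real.Gamma (ρ + 1) := by
  have hΓ := Real.Gamma_pos_of_pos hρ.1
  have hΓ' := Real.Gamma_pos_of_pos (add_pos hρ.1 one_pos)
  have h1 := mlKernel_eq_sub hρ one_pos x one_pos
  have h2 := integral_rpow_mul_mlKernel hρ hρ.1 one_pos x one_pos
  have h3 := integral_beta hρ.1 one_pos one_pos
  have h4 : ∫ s in (0 : ℝ)..1, (1 - s) ^ (ρ - 1) * s ^ ((1 : ℝ) - 1) * mlKernel ρ 1 x 1 ≤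
      ∫ s in (0 : ℝ)..1, (1 - s) ^ (ρ - 1) * mlKernel ρ 1 x s := by
    refine intervalIntegral.integral_mono_on zero_le_one
      ((intervalIntegrable_beta hρ.1 one_pos one_pos).mul_const _)
      (intervalIntegrable_rpow_mul_mlKernel hρ hρ.1 one_pos x one_pos) fun s hs => ?_
    rw [sub_self, Real.rpow_zero, mul_one]
    exact mul_le_mul_of_nonneg_left (mlKernel_one_le hρ hx le_rfl hs.1 hs.2)
      (Real.rpow_nonneg (sub_nonneg.2 hs.2) _)
  rw [intervalIntegral.integral_mul_const, h3, h2] at h4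
  simp only [Real.one_rpow, Real.Gamma_one, mul_one, div_one] at h1 h4
  rw [mlKernel_one_eq, Real.one_rpow, mul_one] at h1 h4
  have h5 : mittagLeffler ρ 1 (-x) ≤ Real.Gamma (ρ + 1) * mlKernel ρ (1 + ρ) x 1 := by
    rw [div_mul_eq_mul_div, mul_div_assoc] at h4
    have h6 := le_of_mul_le_mul_left h4 hΓ
    rwa [div_le_iff₀ hΓ', mul_comm] at h6
  have h7 : 0 ≤ mittagLeffler ρ 1 (-x) := by
    simpa [mlKernel_one_eq] using mlKernel_one_nonneg hρ hx zero_le_one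
  calc x * mittagLeffler ρ 1 (-x) ≤ x * (Real.Gamma (ρ + 1) * mlKernel ρ (1 + ρ) x 1) := by gcongr
    _ = Real.Gamma (ρ + 1) * (x * mlKernel ρ (1 + ρ) x 1) := by ring
    _ ≤ Real.Gamma (ρ + 1) * 1 := by gcongr; linarith
    _ = _ := mul_one _

/-- In `F = J^(1-ρ) e` at time `1`, where `e = mlKernel ρ ρ x`, the kernel `(1 - s) ^ (-ρ)` is at least `1`, and
`x ∫₀¹ e = 1 - F(1)`. -/
theorem one_le_mul_mittagLeffler_one (hρ : ρ ∈ Ioo (0 : ℝ) 1) {x : ℝ} (hx : 0 ≤ x) :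
    1 ≤ (1 + Real.Gamma (1 - ρ) * x) * mittagLeffler ρ 1 (-x) := by
  have h1 := mlKernel_eq_sub hρ one_pos x one_pos
  have h2 := integral_rpow_mul_mlKernel hρ one_pos hρ.1 x one_pos
  have h3 := integral_rpow_mul_mlKernel_self hρ x one_pos
  have h4 : ∫ s in (0 : ℝ)..1, (1 - s) ^ ((1 : ℝ) - 1) * mlKernel ρ ρ x s ≤
      ∫ s in (0 : ℝ)..1, (1 - s) ^ (1 - ρ - 1) * mlKernel ρ ρ x s := by
    refine intervalIntegral.integral_mono_on_of_le_Ioo zero_le_one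
      (intervalIntegrable_rpow_mul_mlKernel hρ one_pos hρ.1 x one_pos)
      (intervalIntegrable_rpow_mul_mlKernel hρ (sub_pos.2 hρ.2) hρ.1 x one_pos) fun s hs => ?_
    refine mul_le_mul_of_nonneg_right ?_ (mlKernel_self_nonneg hρ hx hs.1.le)
    exact Real.rpow_le_rpow_of_exponent_ge (sub_pos.2 hs.2) (by linarith [hs.1])
      (by linarith [hρ.1])
  rw [h2, h3, Real.Gamma_one, one_mul, add_comm ρ] at h4
  simp only [Real.one_rpow, Real.Gamma_one, div_one] at h1
  rw [mlKernel_one_eq, Real.one_rpow, mul_one] at h1 h4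
  have := mul_le_mul_of_nonneg_left h4 hx
  linarith

theorem mittagLeffler_self_le (hρ : ρ ∈ Ioo (0 : ℝ) 1) {x : ℝ} (hx : 0 ≤ x) :
    mittagLeffler ρ ρ (-x) ≤ (Real.Gamma ρ)⁻¹ := by
  have hΓ := Real.Gamma_pos_of_pos hρ.1
  have h1 := mittagLeffler_eq_add hρ hρ.1 (-x)
  have h2 := integral_rpow_mul_mlKernel hρ hρ.1 hρ.1 x one_pos
  have h3 : 0 ≤ ∫ s in (0 : ℝ)..1, (1 - s) ^ (ρ - 1) * mlKernel ρ ρ x s :=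
    intervalIntegral.integral_nonneg zero_le_one fun s hs =>
      mul_nonneg (Real.rpow_nonneg (sub_nonneg.2 hs.2) _) (mlKernel_self_nonneg hρ hx hs.1)
  rw [h2] at h3
  have h4 := nonneg_of_mul_nonneg_right h3 hΓ
  simp only [mlKernel, Real.one_rpow, one_mul, mul_one] at h4
  have := mul_nonneg hx h4
  linarith

/-- By convexity, minus the derivative of `E_{ρ,1}(-x)` at `x` is at most minus the slope over
`[x / 2, x]`. -/
theorem sq_mul_mittagLeffler_self_le (hρ : ρ ∈ Ioo (0 : ℝ) 1) {x : ℝ} (hx : 0 ≤ x) :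
    x ^ 2 * mittagLeffler ρ ρ (-x) ≤ 4 * ρ * Real.Gamma (ρ + 1) := by
  have hρ0 := hρ.1
  have hΓ' := Real.Gamma_pos_of_pos (add_pos hρ.1 one_pos)
  rcases hx.eq_or_lt with rfl | hx
  · simp; positivity
  have hconv := convexOn_mittagLeffler_one hρ
  have h1 := hconv.slope_le_of_hasDerivAt (x := x / 2) (y := x) (by simp; positivity)
    (by simp; positivity) (by linarith) (hasDerivAt_mittagLeffler_one hρ hx)
  rw [slope_def_field, div_le_iff₀ (by linarith)] at h1
  have h2 := mul_mittagLeffler_one_le hρ (x := x / 2) (by positivity)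
  have h3 : 0 ≤ mittagLeffler ρ 1 (-x) := by
    simpa [mlKernel_one_eq] using mlKernel_one_nonneg hρ hx.le zero_le_one
  have h4 : mittagLeffler ρ ρ (-x) / ρ * (x / 2) ≤ mittagLeffler ρ 1 (-(x / 2)) := by linarith
  have h5 := mul_le_mul_of_nonneg_left h4 (show 0 ≤ x / 2 by positivity)
  have h6 : x / 2 * (mittagLeffler ρ ρ (-x) / ρ * (x / 2)) =
      x ^ 2 * mittagLeffler ρ ρ (-x) / (4 * ρ) := by ring
  rw [h6, div_le_iff₀ (by positivity)] at h5
  nlinarith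

/-- By convexity, minus the derivative of `E_{ρ,1}(-x)` at `x` is at least minus the slope over
`[x, M x]`, for any `M > 1`. -/
theorem exists_le_sq_mul_mittagLeffler_self (hρ : ρ ∈ Ioo (0 : ℝ) 1) {x₀ : ℝ} (hx₀ : 0 < x₀) :
    ∃ c > 0, ∀ x, x₀ ≤ x → c ≤ x ^ 2 * mittagLeffler ρ ρ (-x) := by
  have hρ0 := hρ.1
  have hΓ' := Real.Gamma_pos_of_pos (add_pos hρ.1 one_pos)
  have hΓ := Real.Gamma_pos_of_pos (sub_pos.2 hρ.2)
  -- `a / x` bounds `E_{ρ,1}(-x)` from below for `x ≥ x₀`; `M` makes `E_{ρ,1}(-M x) ≤ a / (2 x)`.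
  set a : ℝ := (1 / x₀ + Real.Gamma (1 - ρ))⁻¹ with ha
  have ha0 : 0 < a := by positivity
  set M : ℝ := 2 * Real.Gamma (ρ + 1) / a + 1 with hM
  have hM1 : 0 < M - 1 := by simp only [hM, add_sub_cancel_right]; positivity
  refine ⟨ρ * a / (2 * (M - 1)), by positivity, fun x hx => ?_⟩
  have hx0 : 0 < x := hx₀.trans_le hx
  have hMx : x < M * x := by nlinarith
  have hlow : a ≤ x * mittagLeffler ρ 1 (-x) := by
    have h1 := one_le_mul_mittagLeffler_one hρ hx0.le
    have h3 : 0 ≤ mittagLeffler ρ 1 (-x) := by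
      simpa [mlKernel_one_eq] using mlKernel_one_nonneg hρ hx0.le zero_le_one
    rw [ha, inv_le_iff_one_le_mul₀ (by positivity)]
    refine h1.trans ?_
    have h2 : 1 ≤ x / x₀ := (one_le_div hx₀).2 hx
    calc (1 + Real.Gamma (1 - ρ) * x) * mittagLeffler ρ 1 (-x)
        ≤ (x / x₀ + Real.Gamma (1 - ρ) * x) * mittagLeffler ρ 1 (-x) := by gcongr
      _ = _ := by ring
  have hup : x * mittagLeffler ρ 1 (-(M * x)) ≤ a / 2 := by
    have h1 := mul_mittagLeffler_one_le hρ (hx0.trans hMx).le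
    have h2 : 2 * Real.Gamma (ρ + 1) ≤ a * M := by
      have : a * M = 2 * Real.Gamma (ρ + 1) + a := by rw [hM]; field_simp
      linarith
    have h3 : M * (x * mittagLeffler ρ 1 (-(M * x))) ≤ M * (a / 2) := by linarith
    exact le_of_mul_le_mul_left h3 (by linarith)
  have hconv := convexOn_mittagLeffler_one hρ
  have h1 := hconv.le_slope_of_hasDerivAt (x := x) (y := M * x) hx0.le
    (hx0.trans hMx).le hMx (hasDerivAt_mittagLeffler_one hρ hx0)
  rw [slope_def_field, le_div_iff₀ (by linarith)] at h1
  have h2 : mittagLeffler ρ 1 (-x) - mittagLeffler ρ 1 (-(M * x)) ≤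
      mittagLeffler ρ ρ (-x) / ρ * ((M - 1) * x) := by linarith
  have h3 := mul_le_mul_of_nonneg_left h2 hx0.le
  have h4 : x * (mittagLeffler ρ ρ (-x) / ρ * ((M - 1) * x)) =
      x ^ 2 * mittagLeffler ρ ρ (-x) * ((M - 1) / ρ) := by ring
  rw [h4] at h3
  have h5 : a / 2 ≤ x ^ 2 * mittagLeffler ρ ρ (-x) * ((M - 1) / ρ) := by linarith
  rw [← div_le_iff₀ (by positivity)] at h5
  refine le_trans (le_of_eq ?_) h5
  field_simp

/-- `t ^ (ρ - 1) E_{ρ,ρ}(-λ t ^ ρ)` is bounded by a multiple of `1 / (λ t)`. -/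
theorem mul_mlKernel_self_le (hρ : ρ ∈ Ioo (0 : ℝ) 1) {lam t : ℝ} (hlam : 0 ≤ lam) (ht : 0 < t) :
    lam * mlKernel ρ ρ lam t ≤ ((Real.Gamma ρ)⁻¹ + 4 * ρ * Real.Gamma (ρ + 1)) / t := by
  set x := lam * t ^ ρ with hx
  have hx0 : 0 ≤ x := mul_nonneg hlam (Real.rpow_nonneg ht.le _)
  have h1 := mittagLeffler_self_le hρ hx0
  have h2 := sq_mul_mittagLeffler_self_le hρ hx0
  have h3 := (mittagLeffler_pos hρ hx0).le
  have h4 : x * mittagLeffler ρ ρ (-x) ≤ (1 + x ^ 2) * mittagLeffler ρ ρ (-x) := by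
    gcongr; nlinarith [sq_nonneg (x - 1)]
  rw [le_div_iff₀ ht]
  have h5 : t ^ (ρ - 1) * t = t ^ ρ := by
    rw [← Real.rpow_add_one ht.ne']; simp
  calc lam * mlKernel ρ ρ lam t * t = lam * (t ^ (ρ - 1) * t) * mittagLeffler ρ ρ (-x) := by
        rw [mlKernel]; ring
    _ = x * mittagLeffler ρ ρ (-x) := by rw [h5]
    _ ≤ _ := by linarith

theorem mlKernel_self_le (hρ : ρ ∈ Ioo (0 : ℝ) 1) {lam t : ℝ} (hlam : 0 ≤ lam) (ht : 0 ≤ t) :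
    mlKernel ρ ρ lam t ≤ (Real.Gamma ρ)⁻¹ * t ^ (ρ - 1) := by
  rw [mul_comm]
  exact mul_le_mul_of_nonneg_left
    (mittagLeffler_self_le hρ (mul_nonneg hlam (Real.rpow_nonneg ht _))) (Real.rpow_nonneg ht _)

theorem mlKernel_self_pos (hρ : ρ ∈ Ioo (0 : ℝ) 1) {lam t : ℝ} (hlam : 0 ≤ lam) (ht : 0 < t) :
    0 < mlKernel ρ ρ lam t :=
  mul_pos (Real.rpow_pos_of_pos ht _)
    (mittagLeffler_pos hρ (mul_nonneg hlam (Real.rpow_nonneg ht.le _)))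

/-- For fixed `T`, the kernel `T ^ (ρ - 1) E_{ρ,ρ}(-λ T ^ ρ)` decays in `λ` exactly like `λ⁻²`. -/
theorem exists_sq_mul_mlKernel_self_bounds (hρ : ρ ∈ Ioo (0 : ℝ) 1) {lam₀ T : ℝ}
    (hlam₀ : 0 < lam₀) (hT : 0 < T) : ∃ c > 0, ∃ C > 0, ∀ lam, lam₀ ≤ lam →
      c ≤ lam ^ 2 * mlKernel ρ ρ lam T ∧ lam ^ 2 * mlKernel ρ ρ lam T ≤ C := by
  have hρ0 := hρ.1
  have hΓ' := Real.Gamma_pos_of_pos (add_pos hρ.1 one_pos)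
  have hTρ := Real.rpow_pos_of_pos hT ρ
  have hTρ' := Real.rpow_pos_of_pos hT (ρ - 1)
  obtain ⟨c, hc, hle⟩ := exists_le_sq_mul_mittagLeffler_self hρ (mul_pos hlam₀ hTρ)
  have hK : 0 < T ^ (ρ - 1) / (T ^ ρ) ^ 2 := by positivity
  refine ⟨T ^ (ρ - 1) / (T ^ ρ) ^ 2 * c, by positivity,
    T ^ (ρ - 1) / (T ^ ρ) ^ 2 * (4 * ρ * Real.Gamma (ρ + 1)), by positivity, fun lam hlam => ?_⟩
  have heq : lam ^ 2 * mlKernel ρ ρ lam T = T ^ (ρ - 1) / (T ^ ρ) ^ 2 *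
      ((lam * T ^ ρ) ^ 2 * mittagLeffler ρ ρ (-(lam * T ^ ρ))) := by
    rw [mlKernel]; field_simp
  rw [heq]
  have hl : 0 ≤ lam := hlam₀.le.trans hlam
  exact ⟨mul_le_mul_of_nonneg_left (hle _ (by gcongr)) hK.le,
    mul_le_mul_of_nonneg_left (sq_mul_mittagLeffler_self_le hρ (by positivity)) hK.le⟩

/-! ### Hilbert bases and diagonal self-adjoint operators -/

section HilbertBasis

variable {𝕜 : Type*} [RCLike 𝕜] {H : Type*} [NormedAddCommGroup H] [InnerProductSpace 𝕜 H]
  (v : HilbertBasis ℕ 𝕜 H)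

theorem hasSum_norm_inner_sq (x : H) :
    HasSum (fun k => ‖inner 𝕜 (v k) x‖ ^ 2) (‖x‖ ^ 2) := by
  have h := lp.hasSum_norm (p := 2) (by norm_num) (v.repr x)
  simpa [v.repr_apply_apply] using h

theorem eq_of_forall_inner_eq {x y : H} (h : ∀ k, inner 𝕜 (v k) x = inner 𝕜 (v k) y) : x = y :=
  v.repr.injective (lp.ext (funext fun k => by simpa [v.repr_apply_apply] using h k))

theorem exists_forall_inner_eq {a : ℕ → 𝕜} (ha : Summable fun k => ‖a k‖ ^ 2) :
    ∃ x : H, ∀ k, inner 𝕜 (v k) x = a k := by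
  have hmem : Memℓp a 2 := memℓp_gen (by simpa using ha)
  refine ⟨v.repr.symm ⟨a, hmem⟩, fun k => ?_⟩
  rw [← v.repr_apply_apply, LinearIsometryEquiv.apply_symm_apply]

theorem exists_forall_inner_eq_smul {m : ℕ → ℝ} {C : ℝ} (hm : ∀ k, |m k| ≤ C) (g : H) :
    ∃ x : H, ∀ k, inner 𝕜 (v k) x = m k • inner 𝕜 (v k) g := by
  refine exists_forall_inner_eq v (Summable.of_nonneg_of_le (fun k => by positivity) (fun k => ?_)
    ((hasSum_norm_inner_sq v g).summable.mul_left (C ^ 2)))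
  rw [norm_smul, mul_pow, Real.norm_eq_abs]
  have := hm k
  gcongr

theorem norm_le_of_forall_norm_inner_le {x g : H} {C : ℝ} (hC : 0 ≤ C)
    (h : ∀ k, ‖inner 𝕜 (v k) x‖ ≤ C * ‖inner 𝕜 (v k) g‖) : ‖x‖ ≤ C * ‖g‖ := by
  refine (pow_le_pow_iff_left₀ (norm_nonneg _) (by positivity) two_ne_zero).1 ?_
  rw [mul_pow]
  refine hasSum_le (fun k => ?_) (hasSum_norm_inner_sq v x)
    ((hasSum_norm_inner_sq v g).mul_left (C ^ 2))
  rw [← mul_pow]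
  have := h k
  gcongr

/-- Dominated convergence for Fourier coefficients. -/
theorem tendsto_of_forall_tendsto_inner {ι : Type*} {l : Filter ι} {x : ι → H} {x₀ g : H} {C : ℝ}
    (hb : ∀ᶠ i in l, ∀ k, ‖inner 𝕜 (v k) (x i)‖ ≤ C * ‖inner 𝕜 (v k) g‖)
    (hlim : ∀ k, Tendsto (fun i => inner 𝕜 (v k) (x i)) l (𝓝 (inner 𝕜 (v k) x₀))) :
    Tendsto x l (𝓝 x₀) := by
  rcases l.eq_or_neBot with rfl | hl
  · exact tendsto_bot
  have hb₀ : ∀ k, ‖inner 𝕜 (v k) x₀‖ ≤ C * ‖inner 𝕜 (v k) g‖ := fun k =>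
    le_of_tendsto (hlim k).norm (hb.mono fun i hi => hi k)
  have h1 : Tendsto (fun i => ∑' k, ‖inner 𝕜 (v k) (x i) - inner 𝕜 (v k) x₀‖ ^ 2) l
      (𝓝 (∑' _ : ℕ, (0 : ℝ))) := by
    refine tendsto_tsum_of_dominated_convergence
      (((hasSum_norm_inner_sq v g).summable.mul_left ((2 * C) ^ 2))) (fun k => ?_)
      (hb.mono fun i hi k => ?_)
    · have := ((hlim k).sub_const (inner 𝕜 (v k) x₀)).norm.pow 2
      simpa using this
    · rw [Real.norm_of_nonneg (by positivity), ← mul_pow]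
      have h2 := norm_sub_le (inner 𝕜 (v k) (x i)) (inner 𝕜 (v k) x₀)
      have h3 := hi k
      have h4 := hb₀ k
      gcongr
      linarith
  rw [tsum_zero] at h1
  rw [tendsto_iff_norm_sub_tendsto_zero]
  have h5 := (Real.continuous_sqrt.tendsto 0).comp h1
  rw [Real.sqrt_zero] at h5
  refine h5.congr fun i => ?_
  simp only [Function.comp, ← inner_sub_right]
  rw [(hasSum_norm_inner_sq v (x i - x₀)).tsum_eq, Real.sqrt_sq (norm_nonneg _)]

variable [CompleteSpace H] {A : H →ₗ.[𝕜] H} {lam : ℕ → ℝ}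

theorem inner_apply_of_isSelfAdjoint (hA : IsSelfAdjoint A) (hdom : ∀ k, v k ∈ A.domain)
    (heig : ∀ k, A ⟨v k, hdom k⟩ = (lam k : 𝕜) • v k) (k : ℕ) (x : A.domain) :
    inner 𝕜 (v k) (A x) = (lam k : 𝕜) * inner 𝕜 (v k) (x : H) := by
  have h := LinearPMap.adjoint_isFormalAdjoint hA.dense_domain
  rw [LinearPMap.isSelfAdjoint_def.1 hA] at h
  have := h ⟨v k, hdom k⟩ x
  rw [heig, inner_smul_left, RCLike.conj_ofReal] at this
  exact this.symm

/-- Since `A` equals its adjoint, a vector whose coefficients remain square-summable after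
multiplication by the eigenvalues lies in the domain of `A`, and `A` acts diagonally on it. -/
theorem exists_apply_eq_of_isSelfAdjoint (hA : IsSelfAdjoint A) (hdom : ∀ k, v k ∈ A.domain)
    (heig : ∀ k, A ⟨v k, hdom k⟩ = (lam k : 𝕜) • v k) {x z : H}
    (h : ∀ k, inner 𝕜 (v k) z = (lam k : 𝕜) * inner 𝕜 (v k) x) :
    ∃ hx : x ∈ A.domain, A ⟨x, hx⟩ = z := by
  have hadj := LinearPMap.isSelfAdjoint_def.1 hA
  have hz : ∀ y : A.domain, inner 𝕜 z (y : H) = inner 𝕜 x (A y) := by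
    intro y
    rw [← v.tsum_inner_mul_inner, ← v.tsum_inner_mul_inner]
    refine tsum_congr fun k => ?_
    rw [inner_apply_of_isSelfAdjoint v hA hdom heig, ← inner_conj_symm z, h k, map_mul,
      inner_conj_symm, RCLike.conj_ofReal]
    ring
  have hx : x ∈ A.adjoint.domain := LinearPMap.mem_adjoint_domain_of_exists _ ⟨z, hz⟩
  have hAx := LinearPMap.adjoint_apply_eq hA.dense_domain ⟨x, hx⟩ hz
  rw [LinearPMap.ext_iff] at hadj
  obtain ⟨hd, he⟩ := hadj
  refine ⟨hd ▸ hx, ?_⟩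
  rw [← hAx]
  exact (@he x hx (hd ▸ hx)).symm

end HilbertBasis

/-! ### Fourier coefficients of fractional integrals -/

section Coefficients

variable {E F : Type*} [NormedAddCommGroup E] [NormedSpace ℝ E] [NormedAddCommGroup F]
  [NormedSpace ℝ F] {σ t : ℝ} {u : ℝ → E}

theorem HasFracIntegral.clm_comp (L : E →L[ℝ] F) (h : HasFracIntegral σ u t) :
    HasFracIntegral σ (fun s => L (u s)) t := by
  have h1 : fracIntegrand σ (fun s => L (u s)) t = fun s => L (fracIntegrand σ u t s) := by
    ext s; simp [fracIntegrand]
  rw [HasFracIntegral, h1]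
  exact ⟨L.integrable_comp h.1, L.integrable_comp h.2⟩

theorem HasFracIntegral.fracIntegral_clm_comp [CompleteSpace E] [CompleteSpace F] (L : E →L[ℝ] F)
    (h : HasFracIntegral σ u t) :
    fracIntegral σ (fun s => L (u s)) t = L (fracIntegral σ u t) := by
  have h1 : fracIntegrand σ (fun s => L (u s)) t = fun s => L (fracIntegrand σ u t s) := by
    ext s; simp [fracIntegrand]
  rw [fracIntegral, fracIntegral, h1, map_smul, L.intervalIntegral_comp_comm h]

theorem fracIntegral_mlKernel_smul [CompleteSpace E] (hρ : ρ ∈ Ioo (0 : ℝ) 1) {lam : ℝ}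
    (ht : 0 < t) {c : E} (h : ∀ s, 0 < s → u s = mlKernel ρ ρ lam s • c) :
    fracIntegral (ρ - 1) u t = mlKernel ρ 1 lam t • c := by
  rw [← fracIntegral_mlKernel_self hρ lam ht, fracIntegral_eq _ ht.le, fracIntegral_eq _ ht.le,
    smul_assoc, ← intervalIntegral.integral_smul_const]
  congr 1
  refine intervalIntegral.integral_congr_ae (Eventually.of_forall fun s hs => ?_)
  rw [uIoc_of_le ht.le] at hs
  rw [h s hs.1, smul_assoc]

variable {𝕜 : Type*} [RCLike 𝕜] {H : Type*} [NormedAddCommGroup H] [InnerProductSpace 𝕜 H]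
  [NormedSpace ℝ H] [IsScalarTower ℝ 𝕜 H] (v : HilbertBasis ℕ 𝕜 H)

/-- The `k`-th Fourier coefficient as a real-linear map; its linearity over `ℝ` is that of the
given real structure on `H`, which agrees with the one induced by `𝕜`. -/
def coeffCLM (k : ℕ) : H →L[ℝ] 𝕜 :=
  (innerSL 𝕜 (v k)).restrictScalars ℝ

theorem coeffCLM_apply (k : ℕ) (x : H) : coeffCLM v k x = inner 𝕜 (v k) x := rfl

end Coefficients

/-! ### Solutions in the Hilbert space -/

section Solutions

variable {𝕜 : Type*} [RCLike 𝕜] {H : Type*} [NormedAddCommGroup H] [InnerProductSpace 𝕜 H]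
  [CompleteSpace H] [NormedSpace ℝ H] [IsScalarTower ℝ 𝕜 H] (v : HilbertBasis ℕ 𝕜 H)
  {A : H →ₗ.[𝕜] H} {lam : ℕ → ℝ} {T : ℝ}

/-- The Fourier coefficients of a solution solve the scalar equations, hence are multiples of the
kernels `t ^ (ρ - 1) E_{ρ,ρ}(-λ_k t ^ ρ)`. -/
theorem IsBackwardSolution.exists_coeff (hA : IsSelfAdjoint A) (hdom : ∀ k, v k ∈ A.domain)
    (heig : ∀ k, A ⟨v k, hdom k⟩ = (lam k : 𝕜) • v k) (hlam : ∀ k, 0 < lam k)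
    (hρ : ρ ∈ Ioo (0 : ℝ) 1) (hT : 0 < T) {Φ : H} {u : ℝ → H}
    (hu : IsBackwardSolution A ρ T (fun _ => 0) Φ u) :
    ∃ c : ℕ → 𝕜, ∀ k,
      (∀ t ∈ Ioo 0 T, inner 𝕜 (v k) (fracIntegral (ρ - 1) u t) = mlKernel ρ 1 (lam k) t • c k) ∧
      ∀ t ∈ Ioc 0 T, inner 𝕜 (v k) (u t) = mlKernel ρ ρ (lam k) t • c k := by
  suffices h : ∀ k, ∃ c : 𝕜,
      (∀ t ∈ Ioo 0 T, inner 𝕜 (v k) (fracIntegral (ρ - 1) u t) = mlKernel ρ 1 (lam k) t • c) ∧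
      ∀ t ∈ Ioc 0 T, inner 𝕜 (v k) (u t) = mlKernel ρ ρ (lam k) t • c by
    choose c hc using h
    exact ⟨c, hc⟩
  intro k
  set L := coeffCLM v k with hL
  have hfrac : ∀ t ∈ Ioo 0 T,
      fracIntegral (ρ - 1) (fun s => L (u s)) t = L (fracIntegral (ρ - 1) u t) :=
    fun t ht => (hu.hasFracIntegral t ht).fracIntegral_clm_comp L
  obtain ⟨c, hc⟩ := exists_eq_mlKernel_smul hρ (hlam k) hT (y := fun s => L (u s))
    (fun t ht => (hu.hasFracIntegral t ht).clm_comp L) (fun t ht => by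
      have h1 := L.hasFDerivAt.comp_hasDerivAt t (hu.differentiableAt t ht).hasDerivAt
      have h2 : deriv (fracIntegral (ρ - 1) u) t = -A ⟨u t, hu.mem_domain t ht⟩ :=
        eq_neg_of_add_eq_zero_left (hu.equation t ht)
      rw [h2, map_neg, hL, coeffCLM_apply,
        inner_apply_of_isSelfAdjoint v hA hdom heig] at h1
      rw [RCLike.real_smul_eq_coe_mul]
      refine h1.congr_of_eventuallyEq ?_
      filter_upwards [Ioo_mem_nhds ht.1 ht.2] with s hs using hfrac s hs)
  refine ⟨c, fun t ht => ?_, fun t ht => ?_⟩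
  · rw [← (hc t ht).1, hfrac t ht]; rfl
  · rcases ht.2.lt_or_eq with h | rfl
    · exact (hc t ⟨ht.1, h⟩).2
    -- The final time is reached by continuity.
    · have h1 : Tendsto (fun s => L (u s)) (𝓝[Ioo 0 t] t) (𝓝 (L (u t))) :=
        (L.continuous.tendsto _).comp
          ((hu.continuousOn t ⟨ht.1, le_rfl⟩).tendsto.mono_left
            (nhdsWithin_mono _ Ioo_subset_Ioc_self))
      have h2 : Tendsto (fun s => mlKernel ρ ρ (lam k) s • c) (𝓝[Ioo 0 t] t)
          (𝓝 (mlKernel ρ ρ (lam k) t • c)) :=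
        ((((continuousOn_mlKernel hρ hρ.1 (lam k)).continuousAt
          (Ioi_mem_nhds ht.1)).tendsto).mono_left nhdsWithin_le_nhds).smul_const c
      have : (𝓝[Ioo 0 t] t).NeBot := by
        rw [nhdsWithin_Ioo_eq_nhdsLT ht.1]; infer_instance
      refine tendsto_nhds_unique h1 (h2.congr' ?_)
      filter_upwards [self_mem_nhdsWithin] with s hs using (hc s hs).2.symm

/-- Existence, parametrized by the limit `g` of the fractional integral at `0`. The series with
coefficients `e_k(t)`, `F_k(t)` and `λ_k e_k(t)` times those of `g`, which represent the solution,
its fractional integral and its image under `A`, converge locally uniformly in `t > 0`, the last one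
because `λ e_λ(t)` is bounded by a multiple of `1 / t`. -/
theorem exists_isBackwardSolution (hA : IsSelfAdjoint A) (hdom : ∀ k, v k ∈ A.domain)
    (heig : ∀ k, A ⟨v k, hdom k⟩ = (lam k : 𝕜) • v k) (hlam : ∀ k, 0 < lam k)
    (hρ : ρ ∈ Ioo (0 : ℝ) 1) (hT : 0 < T) {Φ g : H}
    (hg : ∀ k, inner 𝕜 (v k) Φ = mlKernel ρ ρ (lam k) T • inner 𝕜 (v k) g) :
    ∃ u : ℝ → H, IsBackwardSolution A ρ T (fun _ => 0) Φ u := by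
  have hρ0 := hρ.1
  have hΓ := Real.Gamma_pos_of_pos hρ0
  have hΓ' := Real.Gamma_pos_of_pos (add_pos hρ0 one_pos)
  have hl : ∀ k, 0 ≤ lam k := fun k => (hlam k).le
  set K := (Real.Gamma ρ)⁻¹ + 4 * ρ * Real.Gamma (ρ + 1) with hK
  have hK0 : 0 < K := by positivity
  have he0 : ∀ k {t : ℝ}, 0 < t → 0 ≤ mlKernel ρ ρ (lam k) t := fun k t ht =>
    mlKernel_self_nonneg hρ (hl k) ht.le
  -- The values at `t` of the solution, of its fractional integral and of its image under `A`.
  have hex : ∀ t : ℝ, ∃ x y z : H, 0 < t → ∀ k,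
      inner 𝕜 (v k) x = mlKernel ρ ρ (lam k) t • inner 𝕜 (v k) g ∧
      inner 𝕜 (v k) y = mlKernel ρ 1 (lam k) t • inner 𝕜 (v k) g ∧
      inner 𝕜 (v k) z = (lam k * mlKernel ρ ρ (lam k) t) • inner 𝕜 (v k) g := by
    intro t
    by_cases ht : 0 < t
    · obtain ⟨x, hx⟩ := exists_forall_inner_eq_smul v (m := fun k => mlKernel ρ ρ (lam k) t)
        (C := (Real.Gamma ρ)⁻¹ * t ^ (ρ - 1))
        (fun k => by rw [abs_of_nonneg (he0 k ht)]; exact mlKernel_self_le hρ (hl k) ht.le) g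
      obtain ⟨y, hy⟩ := exists_forall_inner_eq_smul v (m := fun k => mlKernel ρ 1 (lam k) t)
        (C := 1) (fun k => by
          rw [abs_of_nonneg (mlKernel_one_nonneg hρ (hl k) ht.le)]
          exact mlKernel_one_le_one hρ (hl k) ht.le) g
      obtain ⟨z, hz⟩ := exists_forall_inner_eq_smul v
        (m := fun k => lam k * mlKernel ρ ρ (lam k) t) (C := K / t) (fun k => by
          rw [abs_of_nonneg (mul_nonneg (hl k) (he0 k ht))]
          exact mul_mlKernel_self_le hρ (hl k) ht) g
      exact ⟨x, y, z, fun _ k => ⟨hx k, hy k, hz k⟩⟩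
    · exact ⟨0, 0, 0, fun h => absurd h ht⟩
  choose u U z hcoeff using hex
  have hu : ∀ t, 0 < t → ∀ k, inner 𝕜 (v k) (u t) = mlKernel ρ ρ (lam k) t • inner 𝕜 (v k) g :=
    fun t ht k => (hcoeff t ht k).1
  have hU : ∀ t, 0 < t → ∀ k, inner 𝕜 (v k) (U t) = mlKernel ρ 1 (lam k) t • inner 𝕜 (v k) g :=
    fun t ht k => (hcoeff t ht k).2.1
  have hz : ∀ t, 0 < t → ∀ k,
      inner 𝕜 (v k) (z t) = (lam k * mlKernel ρ ρ (lam k) t) • inner 𝕜 (v k) g :=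
    fun t ht k => (hcoeff t ht k).2.2
  have hecont : ∀ k {t : ℝ}, 0 < t → ContinuousAt (mlKernel ρ ρ (lam k)) t := fun k t ht =>
    (continuousOn_mlKernel hρ hρ0 (lam k)).continuousAt (Ioi_mem_nhds ht)
  have hu_norm : ∀ t, 0 < t → ∀ k, ‖inner 𝕜 (v k) (u t)‖ ≤
      (Real.Gamma ρ)⁻¹ * t ^ (ρ - 1) * ‖inner 𝕜 (v k) g‖ := by
    intro t ht k
    rw [hu t ht, norm_smul, Real.norm_of_nonneg (he0 k ht)]
    exact mul_le_mul_of_nonneg_right (mlKernel_self_le hρ (hl k) ht.le) (norm_nonneg _)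
  have hu_cont : ContinuousOn u (Ioi 0) := by
    refine fun t ht => ContinuousAt.continuousWithinAt ?_
    have ht : 0 < t := ht
    refine tendsto_of_forall_tendsto_inner v (g := g)
      (C := (Real.Gamma ρ)⁻¹ * (t / 2) ^ (ρ - 1)) ?_ fun k => ?_
    · filter_upwards [Ioi_mem_nhds (half_lt_self ht)] with s hs k
      have hs0 : 0 < s := (half_pos ht).trans hs
      refine (hu_norm s hs0 k).trans ?_
      have := Real.rpow_le_rpow_of_nonpos (half_pos ht) (le_of_lt hs)
        (by linarith [hρ.2] : ρ - 1 ≤ 0)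
      gcongr
    · rw [hu t ht]
      refine (((hecont k ht).tendsto).smul_const _).congr' ?_
      filter_upwards [Ioi_mem_nhds ht] with s hs using (hu s hs k).symm
  have hz_cont : ContinuousOn z (Ioi 0) := by
    refine fun t ht => ContinuousAt.continuousWithinAt ?_
    have ht : 0 < t := ht
    refine tendsto_of_forall_tendsto_inner v (g := g) (C := K / (t / 2)) ?_ fun k => ?_
    · filter_upwards [Ioi_mem_nhds (half_lt_self ht)] with s hs k
      have hs : t / 2 < s := hs
      have hs0 : 0 < s := (half_pos ht).trans hs
      rw [hz s hs0, norm_smul, Real.norm_of_nonneg (mul_nonneg (hl k) (he0 k hs0))]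
      refine mul_le_mul_of_nonneg_right ((mul_mlKernel_self_le hρ (hl k) hs0).trans ?_)
        (norm_nonneg _)
      exact div_le_div_of_nonneg_left hK0.le (half_pos ht) hs.le
    · rw [hz t ht]
      refine ((((hecont k ht).tendsto).const_mul _).smul_const _).congr' ?_
      filter_upwards [Ioi_mem_nhds ht] with s hs using (hz s hs k).symm
  have hfrac : ∀ t, 0 < t → HasFracIntegral (ρ - 1) u t := by
    intro t ht
    have hmaj := ((intervalIntegrable_beta (sub_pos.2 hρ.2) hρ0 ht).mul_const
      ((Real.Gamma ρ)⁻¹ * ‖g‖))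
    refine hmaj.mono_fun' ?_ ?_
    · rw [uIoc_of_le ht.le]
      have h1 : AEStronglyMeasurable u (volume.restrict (Ioc 0 t)) :=
        (hu_cont.mono fun s hs => hs.1).aestronglyMeasurable measurableSet_Ioc
      have h2 : Measurable fun s : ℝ => ((t - s) ^ (ρ - 1 + 1))⁻¹ :=
        ((measurable_const.sub measurable_id).pow_const _).inv
      exact h2.aestronglyMeasurable.smul h1
    · rw [uIoc_of_le ht.le]
      refine (ae_restrict_iff' measurableSet_Ioc).2 (Eventually.of_forall fun s hs => ?_)
      have h1 := norm_le_of_forall_norm_inner_le v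
        (mul_nonneg (inv_nonneg.2 hΓ.le) (Real.rpow_nonneg hs.1.le _)) (hu_norm s hs.1)
      have h2 : 0 ≤ (t - s) ^ (1 - ρ - 1) := Real.rpow_nonneg (sub_nonneg.2 hs.2) _
      simp only
      rw [fracIntegrand_eq hs.2, norm_smul, Real.norm_of_nonneg h2]
      calc (t - s) ^ (1 - ρ - 1) * ‖u s‖
          ≤ (t - s) ^ (1 - ρ - 1) * ((Real.Gamma ρ)⁻¹ * s ^ (ρ - 1) * ‖g‖) := by gcongr
        _ = _ := by ring
  have hfracU : ∀ t, 0 < t → fracIntegral (ρ - 1) u t = U t := by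
    intro t ht
    refine eq_of_forall_inner_eq v fun k => ?_
    rw [hU t ht, ← coeffCLM_apply, ← (hfrac t ht).fracIntegral_clm_comp (coeffCLM v k)]
    exact fracIntegral_mlKernel_smul hρ ht fun s hs => hu s hs k
  have hUderiv : ∀ t, 0 < t → HasDerivAt U (-z t) t := by
    intro t ht
    rw [hasDerivAt_iff_tendsto_slope]
    have hslope : ∀ s, 0 < s → ∀ k, inner 𝕜 (v k) (slope U t s) =
        slope (mlKernel ρ 1 (lam k)) t s • inner 𝕜 (v k) g := by
      intro s hs k
      rw [slope_def_module, slope_def_module, ← coeffCLM_apply, map_smul, map_sub, coeffCLM_apply,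
        coeffCLM_apply, hU s hs, hU t ht, ← sub_smul, smul_assoc]
    refine tendsto_of_forall_tendsto_inner v (g := g) (C := K / (t / 2)) ?_ fun k => ?_
    · filter_upwards [nhdsWithin_le_nhds (Ioi_mem_nhds (half_lt_self ht)), self_mem_nhdsWithin]
        with s hs hst k
      have hs : t / 2 < s := hs
      have hs0 : 0 < s := (half_pos ht).trans hs
      rw [hslope s hs0, norm_smul]
      refine mul_le_mul_of_nonneg_right ?_ (norm_nonneg _)
      have hmv := (convex_Ici (t / 2)).norm_image_sub_le_of_norm_hasDerivWithin_le
        (f := mlKernel ρ 1 (lam k)) (f' := fun r => -(lam k * mlKernel ρ ρ (lam k) r))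
        (C := K / (t / 2)) (x := t) (y := s)
        (fun r hr => (hasDerivAt_mlKernel_one hρ (lam k)
          ((half_pos ht).trans_le hr)).hasDerivWithinAt)
        (fun r hr => by
          have hr0 : 0 < r := (half_pos ht).trans_le hr
          rw [norm_neg, Real.norm_of_nonneg (mul_nonneg (hl k) (he0 k hr0))]
          exact (mul_mlKernel_self_le hρ (hl k) hr0).trans
            (div_le_div_of_nonneg_left hK0.le (half_pos ht) hr))
        (half_lt_self ht).le hs.le
      rw [slope_def_module, norm_smul, norm_inv,
        inv_mul_le_iff₀ (norm_pos_iff.2 (sub_ne_zero.2 hst)), mul_comm]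
      exact hmv
    · rw [inner_neg_right, hz t ht, ← neg_smul]
      have h := (hasDerivAt_iff_tendsto_slope.1
        (hasDerivAt_mlKernel_one hρ (lam k) ht)).smul_const (inner 𝕜 (v k) g)
      refine h.congr' ?_
      filter_upwards [nhdsWithin_le_nhds (Ioi_mem_nhds ht)] with s hs using (hslope s hs k).symm
  have hderiv : ∀ t, 0 < t → HasDerivAt (fracIntegral (ρ - 1) u) (-z t) t := by
    intro t ht
    refine (hUderiv t ht).congr_of_eventuallyEq ?_
    filter_upwards [Ioi_mem_nhds ht] with s hs using hfracU s hs
  have happ : ∀ t, 0 < t → ∃ hx : u t ∈ A.domain, A ⟨u t, hx⟩ = z t := fun t ht =>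
    exists_apply_eq_of_isSelfAdjoint v hA hdom heig fun k => by
      rw [hz t ht, hu t ht, mul_smul, RCLike.real_smul_eq_coe_mul]
  refine ⟨u, ?_⟩
  exact
    { continuousOn := hu_cont.mono fun t ht => ht.1
      hasFracIntegral := fun t ht => hfrac t ht.1
      differentiableAt := fun t ht => (hderiv t ht.1).differentiableAt
      continuousOn_rlDeriv :=
        (hz_cont.neg.mono fun t ht => ht.1).congr fun t ht => (hderiv t ht.1).deriv
      mem_domain := fun t ht => (happ t ht.1).1
      continuous_apply := by
        have h : Continuous fun t : Ioo 0 T => z t :=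
          continuousOn_iff_continuous_domRestrict.1 (hz_cont.mono fun t ht => ht.1)
        exact h.congr fun t => ((happ t t.2.1).2).symm
      equation := fun t ht => by
        rw [(happ t ht.1).2, rlDeriv, (hderiv t ht.1).deriv, neg_add_cancel]
      final := eq_of_forall_inner_eq v fun k => by rw [hu T hT, hg] }

end Solutions

theorem rpow_mul_norm_sq {E : Type*} [NormedAddCommGroup E] (lam : ℝ) (a : E) :
    lam ^ ((2 : ℝ) * 2) * ‖a‖ ^ 2 = (lam ^ 2 * ‖a‖) ^ 2 := by
  rw [show (2 : ℝ) * 2 = (4 : ℕ) by norm_num, Real.rpow_natCast]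
  ring

end BackwardSubdiffusion

end

theorem theorem1 {𝕜 : Type*} [RCLike 𝕜] {H : Type*} [NormedAddCommGroup H]
    [InnerProductSpace 𝕜 H] [CompleteSpace H] [NormedSpace ℝ H] [IsScalarTower ℝ 𝕜 H]
    (A : H →ₗ.[𝕜] H) (hA : IsSelfAdjoint A)
    (v : HilbertBasis ℕ 𝕜 H) (lam : ℕ → ℝ)
    (hdom : ∀ k, v k ∈ A.domain)
    (heig : ∀ k, A ⟨v k, hdom k⟩ = (lam k : 𝕜) • v k)
    (hpos : 0 < lam 0) (hmono : Monotone lam) (hlim : Tendsto lam atTop atTop)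
    (ρ : ℝ) (hρ : ρ ∈ Ioo (0 : ℝ) 1) (T : ℝ) (hT : 0 < T) :
    (∀ Φ ∈ BackwardSubdiffusion.powDomain v lam 2,
      ∃ u : ℝ → H, BackwardSubdiffusion.IsBackwardSolution A ρ T (fun _ => 0) Φ u ∧
        ∀ w : ℝ → H, BackwardSubdiffusion.IsBackwardSolution A ρ T (fun _ => 0) Φ w →
          EqOn w u (Ioc 0 T)) ∧
    ∃ C₁ > (0 : ℝ), ∃ C₂ > (0 : ℝ),
      ∀ Φ ∈ BackwardSubdiffusion.powDomain v lam 2, ∀ u : ℝ → H,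
        BackwardSubdiffusion.IsBackwardSolution A ρ T (fun _ => 0) Φ u →
          ∃ L : ℝ,
            Tendsto (fun t => ‖BackwardSubdiffusion.fracIntegral (ρ - 1) u t‖) (𝓝[>] 0) (𝓝 L) ∧
            C₁ * L ≤ BackwardSubdiffusion.powNorm v lam 2 (u T) ∧
            BackwardSubdiffusion.powNorm v lam 2 (u T) ≤ C₂ * L := by
  open BackwardSubdiffusion in
  have hlam : ∀ k, 0 < lam k := fun k => hpos.trans_le (hmono (Nat.zero_le k))
  have hker : ∀ k, 0 < mlKernel ρ ρ (lam k) T := fun k => mlKernel_self_pos hρ (hlam k).le hT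
  obtain ⟨c, hc, C, hC, hbounds⟩ := exists_sq_mul_mlKernel_self_bounds hρ hpos hT
  have hb : ∀ k, c ≤ lam k ^ 2 * mlKernel ρ ρ (lam k) T ∧
      lam k ^ 2 * mlKernel ρ ρ (lam k) T ≤ C := fun k => hbounds _ (hmono (Nat.zero_le k))
  -- The lower bound of the kernels makes the coefficients at `t = 0` square-summable.
  have hg : ∀ Φ ∈ powDomain v lam 2, ∀ a : ℕ → 𝕜,
      (∀ k, inner 𝕜 (v k) Φ = mlKernel ρ ρ (lam k) T • a k) →
      ∃ g : H, ∀ k, inner 𝕜 (v k) g = a k := by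
    intro Φ hΦ a ha
    refine exists_forall_inner_eq v ?_
    have hΦ : Summable fun k => lam k ^ ((2 : ℝ) * 2) * ‖inner 𝕜 (v k) Φ‖ ^ 2 := hΦ
    refine Summable.of_nonneg_of_le (fun k => by positivity) (fun k => ?_)
      (hΦ.mul_left (c⁻¹ ^ 2))
    rw [rpow_mul_norm_sq, ← mul_pow]
    gcongr
    rw [ha k, norm_smul, Real.norm_of_nonneg (hker k).le, ← mul_assoc (lam k ^ 2),
      le_inv_mul_iff₀ hc]
    exact mul_le_mul_of_nonneg_right (hb k).1 (norm_nonneg _)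
  constructor
  · intro Φ hΦ
    have hdiv : ∀ k, inner 𝕜 (v k) Φ = mlKernel ρ ρ (lam k) T •
        ((mlKernel ρ ρ (lam k) T)⁻¹ • inner 𝕜 (v k) Φ) := fun k => by
      rw [smul_inv_smul₀ (hker k).ne']
    obtain ⟨g, hgc⟩ := hg Φ hΦ _ hdiv
    obtain ⟨u, hu⟩ := exists_isBackwardSolution v hA hdom heig hlam hρ hT (Φ := Φ) (g := g)
      fun k => by rw [hgc]; exact hdiv k
    refine ⟨u, hu, fun w hw t ht => eq_of_forall_inner_eq v fun k => ?_⟩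
    obtain ⟨a, ha⟩ := hu.exists_coeff v hA hdom heig hlam hρ hT
    obtain ⟨b, hb⟩ := hw.exists_coeff v hA hdom heig hlam hρ hT
    have h1 := (ha k).2 T ⟨hT, le_rfl⟩
    have h2 := (hb k).2 T ⟨hT, le_rfl⟩
    rw [hu.final] at h1
    rw [hw.final, h1] at h2
    rw [(ha k).2 t ht, (hb k).2 t ht, smul_right_injective 𝕜 (hker k).ne' h2]
  · refine ⟨c, hc, C, hC, fun Φ hΦ u hu => ?_⟩
    obtain ⟨a, ha⟩ := hu.exists_coeff v hA hdom heig hlam hρ hT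
    have hT' : ∀ k, inner 𝕜 (v k) Φ = mlKernel ρ ρ (lam k) T • a k := fun k => by
      rw [← (ha k).2 T ⟨hT, le_rfl⟩, hu.final]
    obtain ⟨g, hga⟩ := hg Φ hΦ a hT'
    refine ⟨‖g‖, Tendsto.norm ?_, ?_⟩
    · refine tendsto_of_forall_tendsto_inner v (g := g) (C := 1) ?_ fun k => ?_
      · filter_upwards [Ioo_mem_nhdsGT hT] with t ht k
        rw [(ha k).1 t ht, hga, norm_smul,
          Real.norm_of_nonneg (mlKernel_one_nonneg hρ (hlam k).le ht.1.le)]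
        exact mul_le_mul_of_nonneg_right (mlKernel_one_le_one hρ (hlam k).le ht.1.le)
          (norm_nonneg _)
      · have h := (((continuous_mlKernel_one hρ (lam k)).tendsto 0).mono_left
          (nhdsWithin_le_nhds (s := Ioi 0))).smul_const (a k)
        rw [mlKernel_one_zero hρ, one_smul] at h
        rw [hga]
        refine h.congr' ?_
        filter_upwards [Ioo_mem_nhdsGT hT] with t ht using ((ha k).1 t ht).symm
    · have hterm : ∀ k, lam k ^ ((2 : ℝ) * 2) * ‖inner 𝕜 (v k) Φ‖ ^ 2 =
          (lam k ^ 2 * mlKernel ρ ρ (lam k) T) ^ 2 * ‖inner 𝕜 (v k) g‖ ^ 2 := fun k => by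
        rw [rpow_mul_norm_sq, hT', hga, norm_smul, Real.norm_of_nonneg (hker k).le]
        ring
      have hsum := hasSum_norm_inner_sq v g
      have hΦ : Summable fun k => lam k ^ ((2 : ℝ) * 2) * ‖inner 𝕜 (v k) Φ‖ ^ 2 := hΦ
      rw [hu.final, powNorm]
      constructor
      · refine Real.le_sqrt_of_sq_le ?_
        rw [mul_pow]
        refine hasSum_le (fun k => ?_) (hsum.mul_left (c ^ 2)) hΦ.hasSum
        rw [hterm]
        have := (hb k).1
        gcongr
      · refine Real.sqrt_le_iff.2 ⟨by positivity, ?_⟩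
        rw [mul_pow]
        refine hasSum_le (fun k => ?_) hΦ.hasSum (hsum.mul_left (C ^ 2))
        rw [hterm]
        have h1 := (hb k).2
        have h2 := hc.le.trans (hb k).1
        gcongr
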